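/- **Setting.** Let $\mathfrak d$ be a finite-dimensional real Lie algebra with an invariant non-degenerate symmetric bilinear form $\langle\cdot,\cdot\rangle$ (of signature $(n,n)$), $\mathfrak g\subset\mathfrak d$ a Lagrangian subalgebra and $\mathfrak h$ an isotropic complement of $\mathfrak g$, so that $\mathfrak d=\mathfrak g\oplus\mathfrak h$ and $\mathfrak h\simeq\mathfrak g^*$. Let $D$ be a connected and simply connected Lie group with Lie algebra $\mathfrak d$ and $G\subset D$ a closed, connected and simply connected Lie subgroup with Lie algebra $\mathfrak g$; $D/G$ carries its quotient manifold structure, on which $D$ and $G$ act by left multiplication (the dressing action). For an action of a Lie group on a manifold, $\hat u(y)=\frac{d}{dt}|_0\exp(tu)\cdot y$; on a $G$-manifold $X$ we also write $Y_X=\hat Y$ for $Y\in\mathfrak g$. Let $e_i$ be a basis of $\mathfrak g$ and $\epsilon^i$ the dual basis of $\mathfrak h$. * $\phi\in\wedge^3\mathfrak g$ is $\phi(a,b,c)=\langle[a,b],c\rangle$ for $a,b,c\in\mathfrak h\simeq\mathfrak g^*$. * $\Pi_G$ is the bivector field on $G$ obtained by restriction of the difference of the left-invariant and the right-invariant bivector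 field on $D$ with value $\frac12\sum_i\epsilon^i\wedge e_i$ at $1$; it is multiplicative. * $\Pi_{D/G}(df,dg)=-\sum_i\hat\epsilon^i(f)\,\hat e_i(g)$ on $D/G$. * $\lambda:T^*(D/G)\to\mathfrak g$ is the dual of $\mathfrak g^*\times D/G\simeq\mathfrak h\times D/G\to T(D/G)$, $(u,s)\mapsto\hat u(s)$. * $\Gamma=G\times D/G\rightrightarrows D/G$ is the action groupoid, with target $\alpha(g,s)=gs$ and source $\beta(g,s)=s$, with the constant section $\phi$ of $\wedge^3A$, $A=\ker T\alpha|_{D/G}\simeq\mathfrak g\times D/G$, and with the bivector field $$\Pi\big((\theta_g,\theta_s),(\theta'_g,\theta'_s)\big)=\Pi_G(\theta_g,\theta'_g)-\Pi_{D/G}(\theta_s,\theta'_s)+\langle\theta'_s,\widehat{L_g^*\theta_g}\rangle-\langle\theta_s,\widehat{L_g^*\theta'_g}\rangle .$$ Let $X$ be a smooth manifold (finite-dimensional, Hausdorff, second countable). A *Hamiltonian $\Gamma$-space* structure on $X$ consists of a smooth map $J:X\to D/G$, a smooth action $\Gamma\times_{D/G}X=\{(\gamma,x):\beta(\gamma)=J(x)\}\to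 X$, $(\gamma,x)\mapsto\gamma\cdot x$, of the groupoid $\Gamma$ with $J(\gamma\cdot x)=\alpha(\gamma)$, and a smooth bivector field $\Pi_X$ on $X$ such that (a) the graph $\{(\gamma,x,\gamma\cdot x)\}$ is coisotropic in $(\Gamma\times X\times X,\ \Pi\oplus\Pi_X\oplus-\Pi_X)$, and (b) $\frac12[\Pi_X,\Pi_X]=\hat\phi$, where $\Gamma(\wedge^3A)\to\mathfrak X^3(X)$ is induced by the infinitesimal action of the Lie algebroid $A$ on $X$, which maps the velocity at $t=0$ of a curve $\gamma_t$ in $\alpha^{-1}(J(x))$ that starts at the unit of $J(x)$ to the velocity of $\gamma_t^{-1}\cdot x$. A *quasi-Poisson space with $D/G$-momentum map* structure on $X$ consists of a smooth action $\Phi:G\times X\to X$, a smooth $G$-equivariant map $J:X\to D/G$ and a smooth bivector field $\Pi_X$ on $X$ such that (i) $\Phi_*(\Pi_G\oplus\Pi_X)=\Pi_X$; (ii) $\frac12[\Pi_X,\Pi_X]=\phi_X$, where $\wedge^3\mathfrak g\to\mathfrak X^3(X)$ is induced by the Lie algebra homomorphism $\mathfrak g\to\mathfrak X(X)$, $Y\mapsto-Y_X$;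 (iii) $\Pi_X^\sharp(J^*\theta)=-(\lambda(\theta))_X(x)$ for all $x\in X$ and $\theta\in T^*_{J(x)}(D/G)$, where $\langle\Pi_X^\sharp a,b\rangle=\Pi_X(a,b)$. **Theorem.** There is a bijection between the Hamiltonian $\Gamma$-space structures on $X$ and the quasi-Poisson space structures with $D/G$-momentum map on $X$. It keeps $J$ and $\Pi_X$, and takes the action of $\Gamma$ to the action $g\cdot x=(g,J(x))\cdot x$ of $G$. -/

import Mathlib

open scoped Manifold ContDiff Topology

noncomputable section

set_option linter.unusedSectionVars false

namespace QuasiPoisson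

/-! ### Auxiliary instances -/

instance : ENat.LEInfty (minSmoothness ℝ 3) := ⟨by
  simpa using ENat.LEInfty.out (m := (3 : ℕ∞ω))⟩

instance (E : Type*) [NormedAddCommGroup E] [NormedSpace ℝ E] [FiniteDimensional ℝ E] :
    CompleteSpace E := FiniteDimensional.complete ℝ E

instance {E : Type*} [NormedAddCommGroup E] [NormedSpace ℝ E] [FiniteDimensional ℝ E]
    {H : Type*} [TopologicalSpace H] (I : ModelWithCorners ℝ E H)
    {M : Type*} [TopologicalSpace M] [ChartedSpace H M] (x : M) :
    FiniteDimensional ℝ (TangentSpace I x) := inferInstanceAs (FiniteDimensional ℝ E)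

/-! ### Multivector fields on manifolds -/

section Multivectors

variable {E : Type*} [NormedAddCommGroup E] [NormedSpace ℝ E]
  {H : Type*} [TopologicalSpace H] (I : ModelWithCorners ℝ E H)
  {M : Type*} [TopologicalSpace M] [ChartedSpace H M]
  {E' : Type*} [NormedAddCommGroup E'] [NormedSpace ℝ E']
  {H' : Type*} [TopologicalSpace H'] (I' : ModelWithCorners ℝ E' H')
  {N : Type*} [TopologicalSpace N] [ChartedSpace H' N]

/-- The cotangent space of `M` at `x`. -/
abbrev Cotangent (x : M) : Type _ := TangentSpace I x →L[ℝ] ℝ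

/-- The differential `(d f)_x` of a real function. -/
def differential (f : M → ℝ) (x : M) : Cotangent I x := mfderiv I 𝓘(ℝ, ℝ) f x

/-- The pull-back of covectors along a linear map. -/
def pullbackCovector {V W : Type*} [AddCommGroup V] [Module ℝ V] [TopologicalSpace V]
    [AddCommGroup W] [Module ℝ W] [TopologicalSpace W] (L : V →L[ℝ] W) :
    (W →L[ℝ] ℝ) →ₗ[ℝ] (V →L[ℝ] ℝ) where
  toFun a := a.comp L
  map_add' _ _ := rfl
  map_smul' _ _ := rfl

/-- The component in `T^*M` of a covector on `M × N`. -/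
def covectorFst (p : M × N) : Cotangent (I.prod I') p →ₗ[ℝ] Cotangent I p.1 :=
  pullbackCovector
    (ContinuousLinearMap.inl ℝ E E' : TangentSpace I p.1 →L[ℝ] TangentSpace (I.prod I') p)

/-- The component in `T^*N` of a covector on `M × N`. -/
def covectorSnd (p : M × N) : Cotangent (I.prod I') p →ₗ[ℝ] Cotangent I' p.2 :=
  pullbackCovector
    (ContinuousLinearMap.inr ℝ E E' : TangentSpace I' p.2 →L[ℝ] TangentSpace (I.prod I') p)

variable (M) in
/-- A field of bivectors on `M`. An element of `⋀² (T_x M)` is given by its values on pairs of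
covectors, that is, as an alternating bilinear form on the cotangent space. -/
@[ext]
structure BivectorField where
  /-- The value `Π_x (a, b)`. -/
  bilin : ∀ x : M, LinearMap.BilinForm ℝ (Cotangent I x)
  isAlt : ∀ x, (bilin x).IsAlt

variable {I I'}

namespace BivectorField

/-- The bracket `{f, g} = Π (d f, d g)`. -/
def bracket (P : BivectorField I M) (f g : M → ℝ) : M → ℝ :=
  fun x => P.bilin x (differential I f x) (differential I g x)

/-- The bivector field is smooth. -/
def IsSmooth (P : BivectorField I M) : Prop :=
  ∀ f g : M → ℝ, ContMDiff I 𝓘(ℝ, ℝ) ∞ f → ContMDiff I 𝓘(ℝ, ℝ) ∞ g →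
    ContMDiff I 𝓘(ℝ, ℝ) ∞ (P.bracket f g)

/-- The bivector field `-Π`. -/
def neg (P : BivectorField I M) : BivectorField I M where
  bilin x := -P.bilin x
  isAlt x a := by simp [P.isAlt x a]

/-- The value `[P, Q] (d f, d g, d h)` of the Schouten bracket of two bivector fields, where
the Schouten bracket extends the Lie bracket of vector fields and trivectors are evaluated on
covectors by `(X ∧ Y ∧ Z) (a, b, c) = det`. -/
def schouten (P Q : BivectorField I M) (f g h : M → ℝ) : M → ℝ :=
  P.bracket f (Q.bracket g h) + P.bracket g (Q.bracket h f) + P.bracket h (Q.bracket f g)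
    + Q.bracket f (P.bracket g h) + Q.bracket g (P.bracket h f) + Q.bracket h (P.bracket f g)

/-- The bivector field `P ⊕ Q` on a product manifold. -/
def prod (P : BivectorField I M) (Q : BivectorField I' N) :
    BivectorField (I.prod I') (M × N) where
  bilin p := (P.bilin p.1).compl₁₂ (covectorFst I I' p) (covectorFst I I' p)
    + (Q.bilin p.2).compl₁₂ (covectorSnd I I' p) (covectorSnd I I' p)
  isAlt p a := by
    simp only [LinearMap.add_apply, LinearMap.compl₁₂_apply]
    rw [P.isAlt, Q.isAlt, add_zero]

/-- `φ_* P = Q`: at every point `φ` maps the bivector `P` to the bivector `Q`. -/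
def MapsTo (P : BivectorField I M) (Q : BivectorField I' N) (φ : M → N) : Prop :=
  ∀ p (a b : Cotangent I' (φ p)),
    P.bilin p (a.comp (mfderiv I I' φ p)) (b.comp (mfderiv I I' φ p)) = Q.bilin (φ p) a b

end BivectorField

variable (I)

/-- The curve `c` is smooth at time `0`, where it passes through `p` with velocity `v`. -/
def HasVelocity (c : ℝ → M) (p : M) (v : TangentSpace I p) : Prop :=
  c 0 = p ∧ ContMDiffAt 𝓘(ℝ, ℝ) I ∞ c 0 ∧ (mfderiv 𝓘(ℝ, ℝ) I c 0 (1 : ℝ) : E) = v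

/-- The conormal space of the submanifold `C` at `p`: the covectors that vanish on
the velocities at `p` of the curves in `C`. -/
def conormal (C : Set M) (p : M) : Set (Cotangent I p) :=
  {a | ∀ (c : ℝ → M) (v : TangentSpace I p), HasVelocity I c p v →
    (∀ᶠ t in 𝓝 (0 : ℝ), c t ∈ C) → a v = 0}

variable {I}

/-- The submanifold `C` is coisotropic for `P`: the bivector `P` vanishes on the conormal
bundle of `C`. -/
def IsCoisotropic (P : BivectorField I M) (C : Set M) : Prop :=
  ∀ p ∈ C, ∀ a ∈ conormal I C p, ∀ b ∈ conormal I C p, P.bilin p a b = 0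

variable (I I') in
/-- A map defined on a subset of a manifold (here always a submanifold) is smooth if locally it
extends to a smooth map on an open subset. -/
def SmoothOnSubset {A : Set M} (f : A → N) : Prop :=
  ∀ p : A, ∃ U : Set M, IsOpen U ∧ (p : M) ∈ U ∧
    ∃ F : M → N, ContMDiffOn I I' ∞ F U ∧ ∀ q : A, (q : M) ∈ U → F q = f q

end Multivectors

/-! ### Lie groupoids and their Hamiltonian spaces -/

section Groupoids

variable {EΓ : Type*} [NormedAddCommGroup EΓ] [NormedSpace ℝ EΓ] [FiniteDimensional ℝ EΓ]
  {HΓ : Type*} [TopologicalSpace HΓ] (IΓ : ModelWithCorners ℝ EΓ HΓ)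
  (Γ : Type*) [TopologicalSpace Γ] [ChartedSpace HΓ Γ]
  {EM : Type*} [NormedAddCommGroup EM] [NormedSpace ℝ EM] [FiniteDimensional ℝ EM]
  {HM : Type*} [TopologicalSpace HM] (IM : ModelWithCorners ℝ EM HM)
  (M : Type*) [TopologicalSpace M] [ChartedSpace HM M]

/-- A Lie groupoid `Γ ⇉ M` with target `α` and source `β`; the product `g h` is defined when
`β g = α h`. -/
structure LieGroupoid where
  α : Γ → M
  β : Γ → M
  unit : M → Γ
  inv : Γ → Γ
  mul : ∀ g h : Γ, β g = α h → Γ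
  α_mul : ∀ g h (p : β g = α h), α (mul g h p) = α g
  β_mul : ∀ g h (p : β g = α h), β (mul g h p) = β h
  α_unit : ∀ m, α (unit m) = m
  β_unit : ∀ m, β (unit m) = m
  α_inv : ∀ g, α (inv g) = β g
  β_inv : ∀ g, β (inv g) = α g
  mul_assoc : ∀ g h k (p : β g = α h) (q : β h = α k),
    mul (mul g h p) k ((β_mul g h p).trans q) = mul g (mul h k q) (p.trans (α_mul h k q).symm)
  unit_mul : ∀ g, mul (unit (α g)) g (β_unit (α g)) = g
  mul_unit : ∀ g, mul g (unit (β g)) (α_unit (β g)).symm = g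
  mul_inv : ∀ g, mul g (inv g) (α_inv g).symm = unit (α g)
  inv_mul : ∀ g, mul (inv g) g (β_inv g) = unit (β g)
  smooth_α : ContMDiff IΓ IM ∞ α
  smooth_β : ContMDiff IΓ IM ∞ β
  /-- `α` is a submersion -/
  submersion_α : ∀ g, Function.Surjective (mfderiv IΓ IM α g)
  /-- `β` is a submersion -/
  submersion_β : ∀ g, Function.Surjective (mfderiv IΓ IM β g)
  smooth_unit : ContMDiff IM IΓ ∞ unit
  smooth_inv : ContMDiff IΓ IΓ ∞ inv
  smooth_mul : SmoothOnSubset (IΓ.prod IΓ) IΓ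
    (fun p : {p : Γ × Γ | β p.1 = α p.2} => mul p.1.1 p.1.2 p.2)

variable {IΓ Γ IM M}

/-- The fibre at `m` of the Lie algebroid `A = ker Tα|_M` of a Lie groupoid, whose
sections are identified with the left-invariant vector fields. -/
def LieGroupoid.algebroid (𝒢 : LieGroupoid IΓ Γ IM M) (m : M) :
    Submodule ℝ (TangentSpace IΓ (𝒢.unit m)) :=
  LinearMap.ker (mfderiv IΓ IM 𝒢.α (𝒢.unit m)).toLinearMap

/-- A field of trivectors on the Lie algebroid: elements of `⋀³ A_m` are given as alternating
trilinear forms on `A_m^*`. -/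
abbrev LieGroupoid.Trivector (𝒢 : LieGroupoid IΓ Γ IM M) : Type _ :=
  ∀ m : M, (Module.Dual ℝ (𝒢.algebroid m)) [⋀^Fin 3]→ₗ[ℝ] ℝ

variable {EX : Type*} [NormedAddCommGroup EX] [NormedSpace ℝ EX] [FiniteDimensional ℝ EX]
  {HX : Type*} [TopologicalSpace HX] (IX : ModelWithCorners ℝ EX HX)
  (X : Type*) [TopologicalSpace X] [ChartedSpace HX X]

/-- A (left) `Γ`-space with momentum map `J : X → M`. -/
@[ext]
structure GroupoidSpace (𝒢 : LieGroupoid IΓ Γ IM M) where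
  J : X → M
  act : ∀ (g : Γ) (x : X), 𝒢.β g = J x → X
  smooth_J : ContMDiff IX IM ∞ J
  smooth_act : SmoothOnSubset (IΓ.prod IX) IX
    (fun p : {p : Γ × X | 𝒢.β p.1 = J p.2} => act p.1.1 p.1.2 p.2)
  J_act : ∀ g x (p : 𝒢.β g = J x), J (act g x p) = 𝒢.α g
  mul_act : ∀ g h x (p : 𝒢.β g = 𝒢.α h) (q : 𝒢.β h = J x),
    act (𝒢.mul g h p) x ((𝒢.β_mul g h p).trans q)
      = act g (act h x q) (p.trans (J_act h x q).symm)
  unit_act : ∀ x, act (𝒢.unit (J x)) x (𝒢.β_unit (J x)) = x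

variable {IX X}

/-- The family `ρ_x : A_{J x} → T_x X` is the infinitesimal action `Y ↦ Ŷ` of the Lie algebroid
`A = ker Tα|_M` on the `Γ`-space: if `γ_t` is a curve in the fibre `α⁻¹ (J x)` that starts at the
unit with velocity `Y`, then `Ŷ (x)` is the velocity of `γ_t⁻¹ · x` at `t = 0`. -/
def GroupoidSpace.IsInfinitesimalAction {𝒢 : LieGroupoid IΓ Γ IM M} (S : GroupoidSpace IX X 𝒢)
    (ρ : ∀ x : X, 𝒢.algebroid (S.J x) →ₗ[ℝ] TangentSpace IX x) : Prop :=
  ∀ (x : X) (Y : 𝒢.algebroid (S.J x)) (γ : ℝ → Γ) (hγ : ∀ t, 𝒢.α (γ t) = S.J x),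
    HasVelocity IΓ γ (𝒢.unit (S.J x)) Y →
      HasVelocity IX (fun t => S.act (𝒢.inv (γ t)) x ((𝒢.β_inv (γ t)).trans (hγ t))) x (ρ x Y)

variable (IX X)

/-- A Hamiltonian `Γ`-space of a Lie groupoid `Γ ⇉ M` with a bivector field `Π` on `Γ` and a
section `Ω` of `⋀³ A` (for a quasi-Poisson groupoid `(Γ ⇉ M, Π, Ω)`). -/
@[ext]
structure HamiltonianSpace (𝒢 : LieGroupoid IΓ Γ IM M) (P : BivectorField IΓ Γ)
    (Ω : 𝒢.Trivector) extends GroupoidSpace IX X 𝒢 where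
  /-- The bivector field `Π_X`. -/
  bivector : BivectorField IX X
  smooth_bivector : bivector.IsSmooth
  /-- The graph of the action is coisotropic in `(Γ × X × X, Π ⊕ Π_X ⊕ -Π_X)`. -/
  coisotropic : IsCoisotropic (P.prod (bivector.prod bivector.neg))
    {p : Γ × X × X | ∃ h : 𝒢.β p.1 = J p.2.1, p.2.2 = act p.1 p.2.1 h}
  /-- `½ [Π_X, Π_X] = Ω̂`, tested on triples of exact one-forms. -/
  half_schouten : ∃ ρ : ∀ x : X, 𝒢.algebroid (J x) →ₗ[ℝ] TangentSpace IX x,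
    toGroupoidSpace.IsInfinitesimalAction ρ ∧
    ∀ f g h : X → ℝ, ContMDiff IX 𝓘(ℝ, ℝ) ∞ f → ContMDiff IX 𝓘(ℝ, ℝ) ∞ g →
      ContMDiff IX 𝓘(ℝ, ℝ) ∞ h → ∀ x,
      (1 / 2 : ℝ) * bivector.schouten bivector f g h x =
        Ω (J x) ![(differential IX f x).toLinearMap ∘ₗ ρ x,
          (differential IX g x).toLinearMap ∘ₗ ρ x, (differential IX h x).toLinearMap ∘ₗ ρ x]

end Groupoids

/-! ### Action groupoids -/

section Action

variable {EK : Type*} [NormedAddCommGroup EK] [NormedSpace ℝ EK] [FiniteDimensional ℝ EK]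
  {K : Type*} [TopologicalSpace K] [ChartedSpace EK K] [Group K] [LieGroup 𝓘(ℝ, EK) ∞ K]
  {EY : Type*} [NormedAddCommGroup EY] [NormedSpace ℝ EY] [FiniteDimensional ℝ EY]
  {Y : Type*} [TopologicalSpace Y] [ChartedSpace EY Y]

/-- The fundamental vector field `X ↦ d/dt|₀ exp (t X) · y` of an action of a Lie group, as the
derivative at `1` of the orbit map. -/
def fundamental (act : K → Y → Y) (y : Y) :
    GroupLieAlgebra 𝓘(ℝ, EK) K →L[ℝ] TangentSpace 𝓘(ℝ, EY) y :=
  (mfderiv 𝓘(ℝ, EK) 𝓘(ℝ, EY) (fun k => act k y) 1 : EK →L[ℝ] EY)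

variable (K Y) [MulAction K Y] [ContMDiffSMul 𝓘(ℝ, EK) 𝓘(ℝ, EY) ∞ K Y]

/-- A smooth action `K × Y → Y` is a submersion. -/
theorem surjective_mfderiv_smul (p : K × Y) : Function.Surjective
    (mfderiv (𝓘(ℝ, EK).prod 𝓘(ℝ, EY)) 𝓘(ℝ, EY) (fun q : K × Y => q.1 • q.2) p) := by
  have hf : MDifferentiableAt (𝓘(ℝ, EK).prod 𝓘(ℝ, EY)) 𝓘(ℝ, EY)
      (fun q : K × Y => q.1 • q.2) (p.1, p.1⁻¹ • (p.1 • p.2)) :=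
    (contMDiff_smul (n := ∞)).mdifferentiableAt (by simp)
  have hs : ContMDiff 𝓘(ℝ, EY) 𝓘(ℝ, EY) ∞ (fun y : Y => p.1⁻¹ • y) :=
    (contMDiff_smul (I := 𝓘(ℝ, EK)) (n := ∞)).comp (contMDiff_const.prodMk contMDiff_id)
  have hg : MDifferentiableAt 𝓘(ℝ, EY) (𝓘(ℝ, EK).prod 𝓘(ℝ, EY))
      (fun y : Y => (p.1, p.1⁻¹ • y)) (p.1 • p.2) :=
    ((contMDiff_const (c := p.1)).prodMk hs).mdifferentiableAt (by simp)
  have h := mfderiv_comp (p.1 • p.2) hf hg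
  have e : (fun q : K × Y => q.1 • q.2) ∘ (fun y : Y => (p.1, p.1⁻¹ • y)) = id := by
    funext y; simp
  rw [e, mfderiv_id] at h
  intro v
  have h1 : (p.1, p.1⁻¹ • (p.1 • p.2)) = p := by simp
  have hv := DFunLike.congr_fun h v
  rw [← h1]
  exact ⟨_, hv.symm.trans (by simp)⟩

/-- The action groupoid `K × Y ⇉ Y` with `α (k, y) = k y`, `β (k, y) = y` and
`(k, l y) (l, y) = (k l, y)`. -/
def actionGroupoid : LieGroupoid (𝓘(ℝ, EK).prod 𝓘(ℝ, EY)) (K × Y) 𝓘(ℝ, EY) Y where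
  α p := p.1 • p.2
  β p := p.2
  unit y := (1, y)
  inv p := (p.1⁻¹, p.1 • p.2)
  mul p q _ := (p.1 * q.1, q.2)
  α_mul p q h := by simp only [mul_smul]; exact congrArg (p.1 • ·) h.symm
  β_mul _ _ _ := rfl
  α_unit y := one_smul K y
  β_unit _ := rfl
  α_inv p := inv_smul_smul p.1 p.2
  β_inv _ := rfl
  mul_assoc p q r _ _ := by simp [mul_assoc]
  unit_mul p := by simp
  mul_unit p := by simp
  mul_inv p := by simp
  inv_mul p := by simp
  smooth_α := contMDiff_smul
  smooth_β := contMDiff_snd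
  submersion_α p := surjective_mfderiv_smul K Y p
  submersion_β p := by
    rw [mfderiv_snd]
    exact fun v => ⟨(0, v), rfl⟩
  smooth_unit := contMDiff_const.prodMk contMDiff_id
  smooth_inv := ((contMDiff_inv 𝓘(ℝ, EK) ∞).comp contMDiff_fst).prodMk contMDiff_smul
  smooth_mul p := by
    refine ⟨Set.univ, isOpen_univ, trivial, fun p => (p.1.1 * p.2.1, p.2.2), ?_, fun _ _ => rfl⟩
    refine ContMDiff.contMDiffOn ?_
    exact ((contMDiff_fst.comp contMDiff_fst).mul (contMDiff_fst.comp contMDiff_snd)).prodMk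
      (contMDiff_snd.comp contMDiff_snd)

/-- The vector `(X, - X̂ (y))` is tangent to the fibre of `α` at the unit `(1, y)`. -/
theorem toAlgebroid_aux (y : Y) (v : GroupLieAlgebra 𝓘(ℝ, EK) K) :
    ((v, -(fundamental (fun (k : K) (y : Y) => k • y) y : EK →L[ℝ] EY) v) :
      TangentSpace (𝓘(ℝ, EK).prod 𝓘(ℝ, EY)) ((1 : K), y)) ∈
      (actionGroupoid (EK := EK) (EY := EY) K Y).algebroid y := by
  have hf : MDifferentiableAt (𝓘(ℝ, EK).prod 𝓘(ℝ, EY)) 𝓘(ℝ, EY)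
      (fun q : K × Y => q.1 • q.2) (1, y) :=
    (contMDiff_smul (n := ∞)).mdifferentiableAt (by simp)
  have h := mfderiv_prod_eq_add_apply
    (v := ((v, -(fundamental (fun (k : K) (y : Y) => k • y) y : EK →L[ℝ] EY) v) :
      TangentSpace (𝓘(ℝ, EK).prod 𝓘(ℝ, EY)) ((1 : K), y))) hf
  change (mfderiv (𝓘(ℝ, EK).prod 𝓘(ℝ, EY)) 𝓘(ℝ, EY) (fun q : K × Y => q.1 • q.2) (1, y)) _ = 0
  refine h.trans ?_
  have e : (fun z : Y => ((1 : K), y).1 • z) = id := by funext z; simp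
  have e2 : mfderiv 𝓘(ℝ, EY) 𝓘(ℝ, EY) (fun z : Y => ((1 : K), y).1 • z) ((1 : K), y).2
      = (ContinuousLinearMap.id ℝ EY : EY →L[ℝ] EY) := by rw [e]; exact mfderiv_id
  rw [e2]
  exact add_neg_cancel (G := EY) _

/-- The identification `𝔨 ≃ A_y`, `X ↦ (X, - X̂ (y))`, where `X̂` is the fundamental vector field,
of the Lie algebroid of the action groupoid with `𝔨 × Y`. It identifies the constant section `X`
with the left-invariant vector field generated by `X`. -/
def toAlgebroid (y : Y) : GroupLieAlgebra 𝓘(ℝ, EK) K →ₗ[ℝ]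
    (actionGroupoid (EK := EK) (EY := EY) K Y).algebroid y :=
  LinearMap.codRestrict _
    (((ContinuousLinearMap.id ℝ EK).prod
      (-(fundamental (fun (k : K) (y : Y) => k • y) y : EK →L[ℝ] EY)) : EK →L[ℝ] EK × EY) :
      GroupLieAlgebra 𝓘(ℝ, EK) K →L[ℝ]
        TangentSpace (𝓘(ℝ, EK).prod 𝓘(ℝ, EY)) ((1 : K), y)).toLinearMap
    (toAlgebroid_aux K Y y)

/-- The section of `⋀³ A` over the action groupoid given by a constant `φ ∈ ⋀³ 𝔨`. -/
def constantTrivector (φ : Module.Dual ℝ (GroupLieAlgebra 𝓘(ℝ, EK) K) [⋀^Fin 3]→ₗ[ℝ] ℝ) :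
    (actionGroupoid (EK := EK) (EY := EY) K Y).Trivector :=
  fun y => φ.compLinearMap (toAlgebroid K Y y).dualMap

end Action

/-! ### Manin quasi-triples and the groupoid `G × D/G ⇉ D/G` -/

/-- A Manin quasi-triple `(𝔡, 𝔤, 𝔥)`: a Lie algebra `𝔡` with an invariant non-degenerate symmetric
bilinear form, a Lagrangian subalgebra `𝔤` (which forces the signature to be `(n, n)`) and an
isotropic complement `𝔥` of `𝔤`. -/
structure ManinQuasiTriple (𝔡 : Type*) [LieRing 𝔡] [LieAlgebra ℝ 𝔡] where
  form : LinearMap.BilinForm ℝ 𝔡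
  form_symm : ∀ u v, form u v = form v u
  form_nondegenerate : ∀ u, (∀ v, form u v = 0) → u = 0
  form_invariant : ∀ u v w, form ⁅u, v⁆ w = form u ⁅v, w⁆
  𝔤 : LieSubalgebra ℝ 𝔡
  /-- `𝔤` is Lagrangian: `𝔤` is its own orthogonal space -/
  lagrangian : ∀ u, u ∈ 𝔤 ↔ ∀ v ∈ 𝔤, form u v = 0
  𝔥 : Submodule ℝ 𝔡
  isotropic : ∀ u ∈ 𝔥, ∀ v ∈ 𝔥, form u v = 0
  isCompl : IsCompl 𝔤.toSubmodule 𝔥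

namespace ManinQuasiTriple

variable {𝔡 : Type*} [LieRing 𝔡] [LieAlgebra ℝ 𝔡] (T : ManinQuasiTriple 𝔡)

/-- The projection of `𝔡 = 𝔤 ⊕ 𝔥` onto `𝔤`. -/
def projG : 𝔡 →ₗ[ℝ] 𝔡 := T.𝔤.toSubmodule.projection T.𝔥 T.isCompl

/-- The projection of `𝔡 = 𝔤 ⊕ 𝔥` onto `𝔥`. -/
def projH : 𝔡 →ₗ[ℝ] 𝔡 := T.𝔥.projection T.𝔤.toSubmodule T.isCompl.symm

/-- The element `r = ½ ∑ ε^i ∧ e_i` of `⋀² 𝔡`, for a basis `e_i` of `𝔤` and the dual basis `ε^i` of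
`𝔥`, as a bilinear form on `𝔡 ≃ 𝔡^*`:
`r (u, v) = ½ ∑ (⟨ε^i, u⟩ ⟨e_i, v⟩ - ⟨e_i, u⟩ ⟨ε^i, v⟩)`. -/
def r : LinearMap.BilinForm ℝ 𝔡 :=
  (1 / 2 : ℝ) • (T.form.compl₁₂ T.projG T.projH - T.form.compl₁₂ T.projH T.projG)

theorem r_isAlt : T.r.IsAlt := fun u => by
  simp [r, T.form_symm (T.projH u) (T.projG u)]

/-- The pairing `𝔥 → 𝔤^*` given by the form, where `𝔤` is the image of `L : V → 𝔡`. -/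
def pairing {V : Type*} [AddCommGroup V] [Module ℝ V] (L : V →ₗ[ℝ] 𝔡) :
    T.𝔥 →ₗ[ℝ] Module.Dual ℝ V :=
  T.form.compl₁₂ T.𝔥.subtype L

theorem eq_zero_of_pairing {u : 𝔡} (h1 : ∀ v ∈ T.𝔤, T.form u v = 0)
    (h2 : ∀ v ∈ T.𝔥, T.form u v = 0) : u = 0 := by
  refine T.form_nondegenerate u fun v => ?_
  have hv : v ∈ T.𝔤.toSubmodule ⊔ T.𝔥 := by rw [T.isCompl.sup_eq_top]; trivial
  obtain ⟨a, ha, b, hb, rfl⟩ := Submodule.mem_sup.1 hv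
  rw [map_add, h1 a ha, h2 b hb, add_zero]

theorem pairing_bijective [FiniteDimensional ℝ 𝔡] {V : Type*} [AddCommGroup V] [Module ℝ V]
    [FiniteDimensional ℝ V] (L : V →ₗ[ℝ] 𝔡) (hL : Function.Injective L)
    (hr : LinearMap.range L = T.𝔤.toSubmodule) : Function.Bijective (T.pairing L) := by
  have hG : ∀ v ∈ T.𝔤, ∃ x, L x = v := fun v hv => by
    have : v ∈ LinearMap.range L := hr ▸ hv
    exact this
  have hLG : ∀ x, L x ∈ T.𝔤 := fun x => by
    have : L x ∈ T.𝔤.toSubmodule := hr ▸ LinearMap.mem_range_self L x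
    exact this
  have inj : Function.Injective (T.pairing L) := by
    rw [injective_iff_map_eq_zero]
    intro u hu
    refine Subtype.ext (T.eq_zero_of_pairing (fun v hv => ?_) (T.isotropic u u.2))
    obtain ⟨x, rfl⟩ := hG v hv
    exact DFunLike.congr_fun hu x
  have inj' : Function.Injective (T.pairing L).flip := by
    rw [injective_iff_map_eq_zero]
    intro x hx
    refine hL ((T.eq_zero_of_pairing ((T.lagrangian _).1 (hLG x)) fun v hv => ?_).trans
      (map_zero L).symm)
    rw [T.form_symm]
    exact DFunLike.congr_fun hx ⟨v, hv⟩
  have h1 := LinearMap.finrank_le_finrank_of_injective inj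
  have h2 := LinearMap.finrank_le_finrank_of_injective inj'
  rw [Subspace.dual_finrank_eq] at h1 h2
  refine ⟨inj, (LinearMap.injective_iff_surjective_of_finrank_eq_finrank ?_).1 inj⟩
  rw [Subspace.dual_finrank_eq]
  exact le_antisymm h1 h2

end ManinQuasiTriple

/-- A smooth submersion has smooth local sections. -/
theorem exists_local_section {E : Type*} [NormedAddCommGroup E] [NormedSpace ℝ E]
    {M : Type*} [TopologicalSpace M] [ChartedSpace E M]
    {E' : Type*} [NormedAddCommGroup E'] [NormedSpace ℝ E']
    {N : Type*} [TopologicalSpace N] [ChartedSpace E' N] {f : M → N} {x : M}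
    (h : Manifold.IsSubmersionAt 𝓘(ℝ, E) 𝓘(ℝ, E') ∞ f x) :
    ∃ s : N → M, ContMDiffAt 𝓘(ℝ, E') 𝓘(ℝ, E) ∞ s (f x) ∧ ∀ᶠ y in 𝓝 (f x), f (s y) = y := by
  obtain ⟨F, _, _, h⟩ := h
  set φ := h.domChart
  set ψ := h.codChart
  set c : F := (h.equiv (φ x)).2
  let s : N → M := fun y => φ.symm (h.equiv.symm (ψ y, c))
  have hx : x ∈ φ.source := h.mem_domChart_source
  have hy : f x ∈ ψ.source := h.mem_codChart_source
  have hw : ∀ u ∈ φ.target, ψ (f (φ.symm u)) = (h.equiv u).1 := by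
    intro u hu
    have hu' : u ∈ (h.domChart.extend 𝓘(ℝ, E)).target := by simpa using hu
    have := h.writtenInCharts hu'
    simpa using this
  have h0 : h.equiv.symm (ψ (f x), c) = φ x := by
    have := hw (φ x) (φ.map_source hx)
    rw [φ.left_inv hx] at this
    rw [this]
    exact h.equiv.symm_apply_apply _
  have hψ : ContMDiffAt 𝓘(ℝ, E') 𝓘(ℝ, E') ∞ ψ (f x) :=
    (contMDiffOn_of_mem_maximalAtlas h.codChart_mem_maximalAtlas).contMDiffAt
      (ψ.open_source.mem_nhds hy)
  have hφ : ContMDiffAt 𝓘(ℝ, E) 𝓘(ℝ, E) ∞ φ.symm (φ x) :=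
    (contMDiffOn_symm_of_mem_maximalAtlas h.domChart_mem_maximalAtlas).contMDiffAt
      (φ.open_target.mem_nhds (φ.map_source hx))
  have hlin : ContMDiff 𝓘(ℝ, E') 𝓘(ℝ, E) ∞ (fun v : E' => h.equiv.symm (v, c)) := by
    rw [contMDiff_iff_contDiff]; fun_prop
  have hmid : ContMDiffAt 𝓘(ℝ, E') 𝓘(ℝ, E) ∞ (fun y => h.equiv.symm (ψ y, c)) (f x) :=
    hlin.contMDiffAt.comp (f x) hψ
  refine ⟨s, ContMDiffAt.comp (f x) (by rw [h0]; exact hφ) hmid, ?_⟩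
  have ht : ∀ᶠ y in 𝓝 (f x), h.equiv.symm (ψ y, c) ∈ φ.target :=
    hmid.continuousAt.eventually
      (by simp only [h0]; exact φ.open_target.mem_nhds (φ.map_source hx))
  filter_upwards [ht, ψ.open_source.mem_nhds hy] with y h1 h2
  have h3 : f (s y) ∈ ψ.source := h.source_subset_preimage_source (φ.map_target h1)
  apply ψ.injOn h3 h2
  rw [hw _ h1]
  simp

/-- The action of `D` on `D/G` by left multiplication is smooth. -/
theorem contMDiffSMul_quotient {ED : Type*} [NormedAddCommGroup ED] [NormedSpace ℝ ED]
    {D : Type*} [TopologicalSpace D] [ChartedSpace ED D] [Group D] [LieGroup 𝓘(ℝ, ED) ∞ D]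
    (G : Subgroup D)
    {ES : Type*} [NormedAddCommGroup ES] [NormedSpace ℝ ES] [ChartedSpace ES (D ⧸ G)]
    (h : Manifold.IsSubmersion 𝓘(ℝ, ED) 𝓘(ℝ, ES) ∞ (QuotientGroup.mk : D → D ⧸ G)) :
    ContMDiffSMul 𝓘(ℝ, ED) 𝓘(ℝ, ES) ∞ D (D ⧸ G) := by
  refine ⟨fun p => ?_⟩
  obtain ⟨x, hx⟩ := QuotientGroup.mk_surjective p.2
  obtain ⟨s, hs, hs'⟩ := exists_local_section (h.isSubmersionAt x)
  rw [hx] at hs hs'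
  have h1 : ContMDiffAt (𝓘(ℝ, ED).prod 𝓘(ℝ, ES)) 𝓘(ℝ, ES) ∞
      (fun q : D × (D ⧸ G) => ((q.1 * s q.2 : D) : D ⧸ G)) p :=
    h.contMDiff.contMDiffAt.comp p
      (contMDiffAt_fst.mul (hs.comp p contMDiffAt_snd))
  refine h1.congr_of_eventuallyEq ?_
  filter_upwards [continuousAt_snd.eventually hs'] with q hq
  show q.1 • q.2 = ((q.1 * s q.2 : D) : D ⧸ G)
  conv_lhs => rw [← hq]
  rfl
section Pair

variable {ED : Type*} [NormedAddCommGroup ED] [NormedSpace ℝ ED] [FiniteDimensional ℝ ED]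
  {D : Type*} [TopologicalSpace D] [ChartedSpace ED D] [Group D] [LieGroup 𝓘(ℝ, ED) ∞ D]
  {EG : Type*} [NormedAddCommGroup EG] [NormedSpace ℝ EG] [FiniteDimensional ℝ EG]
  {ES : Type*} [NormedAddCommGroup ES] [NormedSpace ℝ ES] [FiniteDimensional ℝ ES]

/-- `(D, G)` is a group pair of the Manin quasi-triple `(𝔡, 𝔤, 𝔥)`, where `𝔡` is the Lie algebra of
the Lie group `D`: the closed Lie subgroup `G` of `D` has the Lie algebra `𝔤`, and `D/G` carries the
quotient manifold structure, for which `D → D/G` is a smooth submersion. -/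
structure IsGroupPair (T : ManinQuasiTriple (GroupLieAlgebra 𝓘(ℝ, ED) D)) (G : Subgroup D)
    [ChartedSpace EG G] [ChartedSpace ES (D ⧸ G)] : Prop where
  isClosed : IsClosed (G : Set D)
  smooth_incl : ContMDiff 𝓘(ℝ, EG) 𝓘(ℝ, ED) ∞ (Subtype.val : G → D)
  immersion : ∀ g : G, Function.Injective (mfderiv 𝓘(ℝ, EG) 𝓘(ℝ, ED) (Subtype.val : G → D) g)
  lieAlgebra : LinearMap.range
    (mfderiv 𝓘(ℝ, EG) 𝓘(ℝ, ED) (Subtype.val : G → D) 1).toLinearMap = T.𝔤.toSubmodule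
  submersion : Manifold.IsSubmersion 𝓘(ℝ, ED) 𝓘(ℝ, ES) ∞ (QuotientGroup.mk : D → D ⧸ G)

namespace IsGroupPair

variable {T : ManinQuasiTriple (GroupLieAlgebra 𝓘(ℝ, ED) D)} {G : Subgroup D}
  [ChartedSpace EG G] [LieGroup 𝓘(ℝ, EG) ∞ G] [ChartedSpace ES (D ⧸ G)]

/-- The action of `G` on `D/G` by left multiplication (the dressing action) is smooth. -/
theorem contMDiffSMul (P : IsGroupPair (EG := EG) (ES := ES) T G) :
    ContMDiffSMul 𝓘(ℝ, EG) 𝓘(ℝ, ES) ∞ G (D ⧸ G) := by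
  have h := contMDiffSMul_quotient G P.submersion
  refine ⟨?_⟩
  exact (contMDiff_smul (I := 𝓘(ℝ, ED)) (G := D)).comp
    ((P.smooth_incl.comp contMDiff_fst).prodMk contMDiff_snd)

/-- The transformation groupoid `Γ = G × D/G ⇉ D/G`. -/
def groupoid (P : IsGroupPair (EG := EG) (ES := ES) T G) :
    LieGroupoid (𝓘(ℝ, EG).prod 𝓘(ℝ, ES)) (G × (D ⧸ G)) 𝓘(ℝ, ES) (D ⧸ G) :=
  haveI := P.contMDiffSMul
  actionGroupoid G (D ⧸ G)

/-- The inclusion of the Lie algebra of `G` into `𝔡`, with image `𝔤`. -/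
def incl (_ : IsGroupPair (EG := EG) (ES := ES) T G) :
    GroupLieAlgebra 𝓘(ℝ, EG) G →ₗ[ℝ] GroupLieAlgebra 𝓘(ℝ, ED) D :=
  (mfderiv 𝓘(ℝ, EG) 𝓘(ℝ, ED) (Subtype.val : G → D) 1).toLinearMap

/-- The identification `𝔤^* ≃ 𝔥` given by the form: `⟨sharp a, X⟩ = a X` for `X ∈ 𝔤`. -/
def sharp (P : IsGroupPair (EG := EG) (ES := ES) T G) :
    Module.Dual ℝ (GroupLieAlgebra 𝓘(ℝ, EG) G) ≃ₗ[ℝ] T.𝔥 :=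
  (LinearEquiv.ofBijective (T.pairing P.incl)
    (T.pairing_bijective P.incl (P.immersion 1) P.lieAlgebra)).symm

/-- The element `φ` of `⋀³ 𝔤`, `φ (a, b, c) = ⟨[a, b], c⟩` for `a, b, c ∈ 𝔤^* ≃ 𝔥`. -/
def φ (P : IsGroupPair (EG := EG) (ES := ES) T G) :
    Module.Dual ℝ (GroupLieAlgebra 𝓘(ℝ, EG) G) [⋀^Fin 3]→ₗ[ℝ] ℝ where
  toFun v := T.form ⁅(P.sharp (v 0) : GroupLieAlgebra 𝓘(ℝ, ED) D), (P.sharp (v 1)).1⁆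
    (P.sharp (v 2))
  map_update_add' v i a b := by
    rename_i inst
    obtain rfl : inst = instDecidableEqFin 3 := Subsingleton.elim _ _
    fin_cases i <;> simp [Function.update]
  map_update_smul' v i c a := by
    rename_i inst
    obtain rfl : inst = instDecidableEqFin 3 := Subsingleton.elim _ _
    fin_cases i <;> simp [Function.update]
  map_eq_zero_of_eq' v i j h hij := by
    have key : ∀ a b : GroupLieAlgebra 𝓘(ℝ, ED) D, T.form ⁅a, b⁆ b = 0 := fun a b => by
      rw [T.form_invariant, lie_self, map_zero]
    have key' : ∀ a b : GroupLieAlgebra 𝓘(ℝ, ED) D, T.form ⁅b, a⁆ b = 0 := fun a b => by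
      rw [← lie_skew, map_neg, LinearMap.neg_apply, key, neg_zero]
    fin_cases i <;> fin_cases j <;> simp_all

/-- The infinitesimal dressing action of `𝔡` on `D/G`, `u ↦ û (s) = d/dt|₀ exp (t u) s`. -/
def dressing (_ : IsGroupPair (EG := EG) (ES := ES) T G) (s : D ⧸ G) :
    GroupLieAlgebra 𝓘(ℝ, ED) D →ₗ[ℝ] TangentSpace 𝓘(ℝ, ES) s :=
  (fundamental (fun (d : D) (s : D ⧸ G) => d • s) s).toLinearMap

/-- The map `λ : T^*(D/G) → 𝔤`, dual to the dressing action
`𝔤^* × D/G ≃ 𝔥 × D/G → T(D/G)`. -/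
def lam (P : IsGroupPair (EG := EG) (ES := ES) T G) (s : D ⧸ G) :
    Cotangent 𝓘(ℝ, ES) s →ₗ[ℝ] GroupLieAlgebra 𝓘(ℝ, EG) G where
  toFun θ := (Module.evalEquiv ℝ (GroupLieAlgebra 𝓘(ℝ, EG) G)).symm
    (θ.toLinearMap ∘ₗ P.dressing s ∘ₗ T.𝔥.subtype ∘ₗ P.sharp.toLinearMap)
  map_add' a b := by rw [← map_add]; rfl
  map_smul' c a := by rw [RingHom.id_apply, ← map_smul]; rfl

/-- Left translation of covectors: `θ ↦ L_g^* θ ∈ 𝔤^* ≃ 𝔥`, as an element of `𝔡`. -/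
def leftSharp (P : IsGroupPair (EG := EG) (ES := ES) T G) (g : G) :
    Cotangent 𝓘(ℝ, EG) g →ₗ[ℝ] GroupLieAlgebra 𝓘(ℝ, ED) D where
  toFun θ := P.sharp (θ.toLinearMap ∘ₗ
    (mfderiv 𝓘(ℝ, EG) 𝓘(ℝ, EG) (fun k : G => g * k) 1 : EG →L[ℝ] EG).toLinearMap)
  map_add' a b := by rw [← Submodule.coe_add, ← map_add]; rfl
  map_smul' c a := by rw [RingHom.id_apply, ← Submodule.coe_smul, ← map_smul]; rfl

/-- Right translation of covectors: `θ ↦ R_g^* θ ∈ 𝔤^* ≃ 𝔥`, as an element of `𝔡`. -/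
def rightSharp (P : IsGroupPair (EG := EG) (ES := ES) T G) (g : G) :
    Cotangent 𝓘(ℝ, EG) g →ₗ[ℝ] GroupLieAlgebra 𝓘(ℝ, ED) D where
  toFun θ := P.sharp (θ.toLinearMap ∘ₗ
    (mfderiv 𝓘(ℝ, EG) 𝓘(ℝ, EG) (fun k : G => k * g) 1 : EG →L[ℝ] EG).toLinearMap)
  map_add' a b := by rw [← Submodule.coe_add, ← map_add]; rfl
  map_smul' c a := by rw [RingHom.id_apply, ← Submodule.coe_smul, ← map_smul]; rfl

/-- The adjoint action of `D` on `𝔡`. -/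
def Ad (d : D) : GroupLieAlgebra 𝓘(ℝ, ED) D →ₗ[ℝ] GroupLieAlgebra 𝓘(ℝ, ED) D :=
  (mfderiv 𝓘(ℝ, ED) 𝓘(ℝ, ED) (fun x : D => d * x * d⁻¹) 1 : ED →L[ℝ] ED).toLinearMap

/-- The multiplicative bivector field `Π_G` on `G`: the difference of the left-invariant and the
right-invariant bivector field on `D` with value `r` at `1`, which is tangent to `G`.
Translated to `1` from the right it is `Ad_g r - r`. -/
def bivectorG (P : IsGroupPair (EG := EG) (ES := ES) T G) : BivectorField 𝓘(ℝ, EG) G where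
  bilin g := T.r.compl₁₂ (Ad (g : D)⁻¹ ∘ₗ P.rightSharp g) (Ad (g : D)⁻¹ ∘ₗ P.rightSharp g)
    - T.r.compl₁₂ (P.rightSharp g) (P.rightSharp g)
  isAlt g a := by
    simp only [LinearMap.sub_apply, LinearMap.compl₁₂_apply]
    rw [T.r_isAlt, T.r_isAlt, sub_zero]

/-- The bilinear form `(θ, θ') ↦ ∑ ε̂^i (θ) ê_i (θ') = ⟨θ', (λ θ)^⟩` on `T_s^*(D/G)`. -/
def dressingForm (P : IsGroupPair (EG := EG) (ES := ES) T G) (s : D ⧸ G) :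
    LinearMap.BilinForm ℝ (Cotangent 𝓘(ℝ, ES) s) :=
  LinearMap.mk₂ ℝ (fun θ θ' => θ' (P.dressing s (P.incl (P.lam s θ))))
    (fun a b c => by simp) (fun c a b => by simp) (fun a b c => by simp) (fun c a b => by simp)

/-- The bivector field `Π_{D/G}`, `Π_{D/G} (θ, θ') = -∑ ε̂^i (θ) ê_i (θ')`. By invariance of the form
the right hand side is skew-symmetric for connected `D`; it is written here in the manifestly
skew-symmetric form `½ ∑ (ê_i (θ) ε̂^i (θ') - ε̂^i (θ) ê_i (θ'))`. -/
def bivectorQuotient (P : IsGroupPair (EG := EG) (ES := ES) T G) :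
    BivectorField 𝓘(ℝ, ES) (D ⧸ G) where
  bilin s := (1 / 2 : ℝ) • ((P.dressingForm s).flip - P.dressingForm s)
  isAlt s a := by simp

/-- The bilinear map `(θ_g, θ_s) ↦ ⟨θ_s, (L_g^* θ_g)^⟩` at `(g, s)`. -/
def mixedForm (P : IsGroupPair (EG := EG) (ES := ES) T G) (p : G × (D ⧸ G)) :
    Cotangent 𝓘(ℝ, EG) p.1 →ₗ[ℝ] Cotangent 𝓘(ℝ, ES) p.2 →ₗ[ℝ] ℝ :=
  LinearMap.mk₂ ℝ (fun θg θs => θs (P.dressing p.2 (P.leftSharp p.1 θg)))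
    (fun a b c => by simp) (fun c a b => by simp) (fun a b c => by simp) (fun c a b => by simp)

/-- The bivector field on `Γ = G × D/G`,
`Π ((θ_g, θ_s), (θ'_g, θ'_s)) = Π_G (θ_g, θ'_g) - Π_{D/G} (θ_s, θ'_s)
  + ⟨θ'_s, (L_g^* θ_g)^⟩ - ⟨θ_s, (L_g^* θ'_g)^⟩`. -/
def bivector (P : IsGroupPair (EG := EG) (ES := ES) T G) :
    BivectorField (𝓘(ℝ, EG).prod 𝓘(ℝ, ES)) (G × (D ⧸ G)) where
  bilin p := (P.bivectorG.prod P.bivectorQuotient.neg).bilin p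
    + (P.mixedForm p).compl₁₂ (covectorFst _ _ p) (covectorSnd _ _ p)
    - ((P.mixedForm p).compl₁₂ (covectorFst _ _ p) (covectorSnd _ _ p)).flip
  isAlt p a := by
    simp only [LinearMap.sub_apply, LinearMap.add_apply, LinearMap.flip_apply]
    rw [(P.bivectorG.prod P.bivectorQuotient.neg).isAlt, zero_add, sub_self]

/-- The constant section `φ` of `⋀³ A`, where `A = 𝔤 × D/G`. -/
def trivector (P : IsGroupPair (EG := EG) (ES := ES) T G) : P.groupoid.Trivector :=
  haveI := P.contMDiffSMul
  constantTrivector G (D ⧸ G) P.φ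

end IsGroupPair

/-- A quasi-Poisson space with `D/G`-valued momentum map, on the manifold `X`. -/
@[ext]
structure QuasiPoissonSpace {T : ManinQuasiTriple (GroupLieAlgebra 𝓘(ℝ, ED) D)} {G : Subgroup D}
    [ChartedSpace EG G] [LieGroup 𝓘(ℝ, EG) ∞ G] [ChartedSpace ES (D ⧸ G)]
    (P : IsGroupPair (EG := EG) (ES := ES) T G)
    (EX : Type*) [NormedAddCommGroup EX] [NormedSpace ℝ EX]
    (X : Type*) [TopologicalSpace X] [ChartedSpace EX X] where
  /-- The action `Φ : G × X → X`. -/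
  act : G → X → X
  one_act : ∀ x, act 1 x = x
  mul_act : ∀ g h x, act (g * h) x = act g (act h x)
  smooth_act : ContMDiff (𝓘(ℝ, EG).prod 𝓘(ℝ, EX)) 𝓘(ℝ, EX) ∞ (fun p : G × X => act p.1 p.2)
  /-- The momentum map. -/
  J : X → D ⧸ G
  smooth_J : ContMDiff 𝓘(ℝ, EX) 𝓘(ℝ, ES) ∞ J
  /-- `J` is equivariant for the dressing action. -/
  equivariant : ∀ g x, J (act g x) = g • J x
  /-- The bivector field `Π_X`. -/
  bivector : BivectorField 𝓘(ℝ, EX) X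
  smooth_bivector : bivector.IsSmooth
  /-- `Φ_* (Π_G ⊕ Π_X) = Π_X`. -/
  mapsTo_act : (P.bivectorG.prod bivector).MapsTo bivector (fun p : G × X => act p.1 p.2)
  /-- `½ [Π_X, Π_X] = φ_X`, tested on triples of exact one-forms; the infinitesimal action of the
  Lie algebra is the homomorphism `Y ↦ d/dt|₀ exp (- t Y) x`. -/
  half_schouten : ∀ f g h : X → ℝ, ContMDiff 𝓘(ℝ, EX) 𝓘(ℝ, ℝ) ∞ f →
    ContMDiff 𝓘(ℝ, EX) 𝓘(ℝ, ℝ) ∞ g → ContMDiff 𝓘(ℝ, EX) 𝓘(ℝ, ℝ) ∞ h → ∀ x,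
      (1 / 2 : ℝ) * bivector.schouten bivector f g h x =
        P.φ ![(differential 𝓘(ℝ, EX) f x).toLinearMap ∘ₗ (-(fundamental act x)).toLinearMap,
          (differential 𝓘(ℝ, EX) g x).toLinearMap ∘ₗ (-(fundamental act x)).toLinearMap,
          (differential 𝓘(ℝ, EX) h x).toLinearMap ∘ₗ (-(fundamental act x)).toLinearMap]
  /-- `Π_X^♯ (J^* θ) = -(λ θ)_X`, where `⟨Π_X^♯ a, b⟩ = Π_X (a, b)` and `Y_X` is the fundamental
  vector field of `Y ∈ 𝔤`. -/
  momentum : ∀ x (θ : Cotangent 𝓘(ℝ, ES) (J x)) (ζ : Cotangent 𝓘(ℝ, EX) x),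
    bivector.bilin x (θ.comp (mfderiv 𝓘(ℝ, EX) 𝓘(ℝ, ES) J x)) ζ =
      -ζ (fundamental act x (P.lam (J x) θ))

end Pair

end QuasiPoisson

end

/-! An element (g, s) of Γ acts on x only when s = J(x), so an action of Γ on X with momentum map J
amounts to an action of G for which J is equivariant. The rest is a comparison of the conditions on
Π_X.

Coisotropy. The graph of the action is parametrised by (g, x) ↦ ((g, J x), x, g·x). Write Φ_x for
the orbit map and Φ_g for the translation. The conormal space of the graph consists exactly of the
covectors (-Φ_x^*η, θ, -J^*θ - Φ_g^*η, η) with θ and η arbitrary (`graphCovector_mem_conormal`,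
`exists_graphCovector`). On two of them, Π ⊕ Π_X ⊕ -Π_X is a sum of four groups
(`bilin_graphCovector`): in (η, η') the defect of Φ_*(Π_G ⊕ Π_X) = Π_X, in (θ, θ') the defect of
J_*Π_X = Π_{D/G}, and in (θ, η') and (θ', η) the defect of the momentum condition, paired with
Φ_g^*η' or Φ_g^*η. The mixed terms of Π take this shape because ⟨θ, (L_g^*Φ_x^*η)^⟩ = ⟨Φ_g^*η,
(λθ)_X⟩ (`apply_dressing_leftSharp`). As θ, θ', η, η' are independent, coisotropy yields (i) and
(iii). Conversely, (iii) and equivariance of J already give J_*Π_X = Π_{D/G}, by skew-symmetry of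
Π_X (`bilin_pullback_J`), so (i) and (iii) suffice.

Trivectors. A vector of A at s is (Y, -Ŷ(s)), hence determined by Y, and it acts on X as -Y_X. So φ̂
and φ_X are the same trivector field. -/

noncomputable section

set_option linter.unusedSectionVars false

namespace QuasiPoisson

/-! ### Calculus of velocities of curves -/

section Velocity

variable {E : Type*} [NormedAddCommGroup E] [NormedSpace ℝ E]
  {H : Type*} [TopologicalSpace H] {I : ModelWithCorners ℝ E H}
  {M : Type*} [TopologicalSpace M] [ChartedSpace H M]
  {E' : Type*} [NormedAddCommGroup E'] [NormedSpace ℝ E']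
  {H' : Type*} [TopologicalSpace H'] {I' : ModelWithCorners ℝ E' H'}
  {N : Type*} [TopologicalSpace N] [ChartedSpace H' N]

/-- Every tangent vector of a manifold without boundary is the velocity of a curve. -/
theorem exists_hasVelocity {M : Type*} [TopologicalSpace M] [ChartedSpace E M]
    [IsManifold 𝓘(ℝ, E) ∞ M] (p : M) (v : TangentSpace 𝓘(ℝ, E) p) :
    ∃ c : ℝ → M, HasVelocity 𝓘(ℝ, E) c p v := by
  let v' : E := v
  set φ := extChartAt 𝓘(ℝ, E) p
  let l : ℝ → E := fun t => φ p + t • v'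
  have hl0 : l 0 = φ p := by simp [l]
  have h0 : φ.symm (l 0) = p := by rw [hl0]; exact extChartAt_to_inv p
  have hl : ContMDiff 𝓘(ℝ, ℝ) 𝓘(ℝ, E) ∞ l := by
    rw [contMDiff_iff_contDiff]; fun_prop
  have hφ : ContMDiffAt 𝓘(ℝ, E) 𝓘(ℝ, E) ∞ φ.symm (l 0) := by
    rw [hl0]
    exact (contMDiffOn_extChartAt_symm p).contMDiffAt (extChartAt_target_mem_nhds p)
  have hc : ContMDiffAt 𝓘(ℝ, ℝ) 𝓘(ℝ, E) ∞ (fun t => φ.symm (l t)) 0 :=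
    hφ.comp 0 hl.contMDiffAt
  have hlv : HasFDerivAt l ((1 : ℝ →L[ℝ] ℝ).smulRight v') 0 :=
    (((hasFDerivAt_id (0 : ℝ)).smul_const v').const_add (φ p))
  refine ⟨fun t => φ.symm (l t), h0, hc, ?_⟩
  have key : HasMFDerivAt 𝓘(ℝ, ℝ) 𝓘(ℝ, E) (fun t => φ.symm (l t)) 0
      ((1 : ℝ →L[ℝ] ℝ).smulRight v' : ℝ →L[ℝ] E) := by
    -- In the chart at p the curve is the affine line `l`, as long as `l t` stays in the target of
    -- the chart.
    refine ⟨hc.continuousAt, ?_⟩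
    have ht : ∀ᶠ t in 𝓝 (0 : ℝ), l t ∈ φ.target :=
      hl.continuous.continuousAt.eventually (by rw [hl0]; exact extChartAt_target_mem_nhds p)
    have := hlv.congr_of_eventuallyEq (f₁ := fun t => φ (φ.symm (l t)))
      (ht.mono fun t h => φ.right_inv h)
    have hw : HasFDerivWithinAt (fun t => extChartAt 𝓘(ℝ, E) (φ.symm (l 0)) (φ.symm (l t)))
        ((1 : ℝ →L[ℝ] ℝ).smulRight v') (Set.range 𝓘(ℝ, ℝ)) 0 := by
      rw [h0]
      exact this.hasFDerivWithinAt
    exact hw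
  rw [key.mfderiv]
  exact one_smul ℝ v'

namespace HasVelocity

variable {c : ℝ → M} {p : M} {v : TangentSpace I p}

theorem comp (h : HasVelocity I c p v) {f : M → N} (hf : ContMDiffAt I I' ∞ f p) :
    HasVelocity I' (fun t => f (c t)) (f p) (mfderiv I I' f p v) := by
  obtain ⟨rfl, h1, h2⟩ := h
  refine ⟨rfl, hf.comp 0 h1, ?_⟩
  have := mfderiv_comp (0 : ℝ) (hf.mdifferentiableAt (by simp)) (h1.mdifferentiableAt (by simp))
  rw [show (fun t => f (c t)) = f ∘ c from rfl, this]
  exact congrArg (mfderiv I I' f (c 0)) h2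

theorem prodMk (h : HasVelocity I c p v) {d : ℝ → N} {q : N} {w : TangentSpace I' q}
    (h' : HasVelocity I' d q w) :
    HasVelocity (I.prod I') (fun t => (c t, d t)) (p, q) ((v, w) : E × E') := by
  obtain ⟨rfl, h1, h2⟩ := h
  obtain ⟨rfl, h1', h2'⟩ := h'
  refine ⟨rfl, h1.prodMk h1', ?_⟩
  rw [mfderiv_prodMk (h1.mdifferentiableAt (by simp)) (h1'.mdifferentiableAt (by simp))]
  exact Prod.ext h2 h2'

theorem fst {c : ℝ → M × N} {p : M × N} {v : TangentSpace (I.prod I') p}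
    (h : HasVelocity (I.prod I') c p v) :
    HasVelocity I (fun t => (c t).1) p.1 (Prod.fst (α := E) (β := E') v) := by
  have := h.comp (f := Prod.fst) (contMDiffAt_fst (I := I) (J := I') (n := ∞))
  rwa [mfderiv_fst] at this

theorem snd {c : ℝ → M × N} {p : M × N} {v : TangentSpace (I.prod I') p}
    (h : HasVelocity (I.prod I') c p v) :
    HasVelocity I' (fun t => (c t).2) p.2 (Prod.snd (α := E) (β := E') v) := by
  have := h.comp (f := Prod.snd) (contMDiffAt_snd (I := I) (J := I') (n := ∞))
  rwa [mfderiv_snd] at this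

/-- Curves that agree near `0` have the same velocity. -/
theorem eq_of_eventuallyEq (h : HasVelocity I c p v) {d : ℝ → M} {w : TangentSpace I p}
    (h' : HasVelocity I d p w) (hcd : c =ᶠ[𝓝 0] d) : v = w :=
  h.2.2.symm.trans ((congrArg (fun L : ℝ →L[ℝ] E => L 1) hcd.mfderiv_eq).trans h'.2.2)

theorem unique (h : HasVelocity I c p v) {w : TangentSpace I p} (h' : HasVelocity I c p w) :
    v = w :=
  h.eq_of_eventuallyEq h' Filter.EventuallyEq.rfl

theorem const (p : M) : HasVelocity I (fun _ => p) p 0 :=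
  ⟨rfl, contMDiffAt_const, by rw [mfderiv_const]; rfl⟩

end HasVelocity

/-- The velocity of `t ↦ f (c t, d t)` is the sum of the two partial derivatives. -/
theorem HasVelocity.comp₂ {E'' : Type*} [NormedAddCommGroup E''] [NormedSpace ℝ E'']
    {H'' : Type*} [TopologicalSpace H''] {I'' : ModelWithCorners ℝ E'' H''}
    {Q : Type*} [TopologicalSpace Q] [ChartedSpace H'' Q]
    {c : ℝ → M} {p : M} {v : TangentSpace I p} (h : HasVelocity I c p v)
    {d : ℝ → N} {q : N} {w : TangentSpace I' q} (h' : HasVelocity I' d q w)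
    {f : M → N → Q} (hf : ContMDiffAt (I.prod I') I'' ∞ (fun z : M × N => f z.1 z.2) (p, q)) :
    HasVelocity I'' (fun t => f (c t) (d t)) (f p q)
      ((mfderiv I I'' (fun z => f z q) p v + mfderiv I' I'' (f p) q w : E'')) := by
  have h1 := (h.prodMk h').comp hf
  have h2 := mfderiv_prod_eq_add_apply (v := ((v, w) : TangentSpace (I.prod I') (p, q)))
    (hf.mdifferentiableAt (by simp))
  rw [h2] at h1
  exact h1

end Velocity

/-! ### Equivariant actions and the conormal bundle of their graphs -/

section Correspondence

variable {ED : Type*} [NormedAddCommGroup ED] [NormedSpace ℝ ED] [FiniteDimensional ℝ ED]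
  {D : Type*} [TopologicalSpace D] [ChartedSpace ED D] [Group D] [LieGroup 𝓘(ℝ, ED) ∞ D]
  {EG : Type*} [NormedAddCommGroup EG] [NormedSpace ℝ EG] [FiniteDimensional ℝ EG]
  {ES : Type*} [NormedAddCommGroup ES] [NormedSpace ℝ ES] [FiniteDimensional ℝ ES]
  {T : ManinQuasiTriple (GroupLieAlgebra 𝓘(ℝ, ED) D)} {G : Subgroup D}
  [ChartedSpace EG G] [LieGroup 𝓘(ℝ, EG) ∞ G] [ChartedSpace ES (D ⧸ G)]

/-- A smooth action of `G` on `X` with an equivariant map to `D/G`. -/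
structure EquivariantAction (P : IsGroupPair (EG := EG) (ES := ES) T G)
    (EX : Type*) [NormedAddCommGroup EX] [NormedSpace ℝ EX]
    (X : Type*) [TopologicalSpace X] [ChartedSpace EX X] where
  act : G → X → X
  one_act : ∀ x, act 1 x = x
  mul_act : ∀ g h x, act (g * h) x = act g (act h x)
  smooth_act : ContMDiff (𝓘(ℝ, EG).prod 𝓘(ℝ, EX)) 𝓘(ℝ, EX) ∞ (fun p : G × X => act p.1 p.2)
  J : X → D ⧸ G
  smooth_J : ContMDiff 𝓘(ℝ, EX) 𝓘(ℝ, ES) ∞ J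
  equivariant : ∀ g x, J (act g x) = g • J x

namespace EquivariantAction

variable {P : IsGroupPair (EG := EG) (ES := ES) T G}
  {EX : Type*} [NormedAddCommGroup EX] [NormedSpace ℝ EX]
  {X : Type*} [TopologicalSpace X] [ChartedSpace EX X] (A : EquivariantAction P EX X)

theorem smooth_orbit (x : X) : ContMDiff 𝓘(ℝ, EG) 𝓘(ℝ, EX) ∞ (fun g => A.act g x) :=
  A.smooth_act.comp (contMDiff_id.prodMk contMDiff_const)

theorem smooth_translation (g : G) : ContMDiff 𝓘(ℝ, EX) 𝓘(ℝ, EX) ∞ (A.act g) :=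
  A.smooth_act.comp (contMDiff_const.prodMk contMDiff_id)

/-- The derivative at `g` of the orbit map of `x`. -/
def dOrbit (g : G) (x : X) : TangentSpace 𝓘(ℝ, EG) g →L[ℝ] TangentSpace 𝓘(ℝ, EX) (A.act g x) :=
  mfderiv 𝓘(ℝ, EG) 𝓘(ℝ, EX) (fun k => A.act k x) g

/-- The derivative at `x` of the translation by `g`. -/
def dTranslation (g : G) (x : X) :
    TangentSpace 𝓘(ℝ, EX) x →L[ℝ] TangentSpace 𝓘(ℝ, EX) (A.act g x) :=
  mfderiv 𝓘(ℝ, EX) 𝓘(ℝ, EX) (A.act g) x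

/-- The derivative of the momentum map. -/
def dJ (x : X) : TangentSpace 𝓘(ℝ, EX) x →L[ℝ] TangentSpace 𝓘(ℝ, ES) (A.J x) :=
  mfderiv 𝓘(ℝ, EX) 𝓘(ℝ, ES) A.J x

theorem mfderiv_act (g : G) (x : X) (v : EG × EX) :
    mfderiv (𝓘(ℝ, EG).prod 𝓘(ℝ, EX)) 𝓘(ℝ, EX) (fun p : G × X => A.act p.1 p.2) (g, x) v =
      A.dOrbit g x v.1 + A.dTranslation g x v.2 :=
  mfderiv_prod_eq_add_apply (f := fun p : G × X => A.act p.1 p.2) (p := (g, x))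
    (v := (v : TangentSpace (𝓘(ℝ, EG).prod 𝓘(ℝ, EX)) (g, x)))
    (A.smooth_act.mdifferentiableAt (by simp))

/-- The infinitesimal action is equivariant: the orbit map intertwines the left translation of `G`
with the translation of `X`. -/
theorem dOrbit_mul_left (g : G) (x : X) (Y : EG) :
    A.dOrbit g x ((mfderiv 𝓘(ℝ, EG) 𝓘(ℝ, EG) (fun k : G => g * k) 1 : EG →L[ℝ] EG) Y) =
      A.dTranslation g x ((fundamental A.act x : EG →L[ℝ] EX) Y) := by
  -- Both sides are velocities of one curve, (g c_t)·x = g·(c_t·x), where c starts at 1 with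
  -- velocity Y.
  obtain ⟨c, hc⟩ := exists_hasVelocity (1 : G) Y
  have h1 := (hc.comp (f := fun k : G => g * k) (I' := 𝓘(ℝ, EG))
    (contMDiff_mul_left (n := ∞)).contMDiffAt).comp ((A.smooth_orbit x).contMDiffAt)
  have h2 := (hc.comp (A.smooth_orbit x).contMDiffAt).comp ((A.smooth_translation g).contMDiffAt)
  have h3 := h1.2.2.symm.trans
    ((congrArg (fun L : ℝ → X => (mfderiv 𝓘(ℝ, ℝ) 𝓘(ℝ, EX) L 0 : ℝ →L[ℝ] EX) 1)
      (funext fun t => A.mul_act g (c t) x)).trans h2.2.2)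
  -- The chain rule gives derivatives at g * 1 and at 1·x; `e1` and `e2` move them to g and x.
  have e1 : (mfderiv 𝓘(ℝ, EG) 𝓘(ℝ, EX) (fun k => A.act k x) (g * 1) : EG →L[ℝ] EX)
      = mfderiv 𝓘(ℝ, EG) 𝓘(ℝ, EX) (fun k => A.act k x) g := by rw [mul_one]
  have e2 : (mfderiv 𝓘(ℝ, EX) 𝓘(ℝ, EX) (A.act g) (A.act 1 x) : EX →L[ℝ] EX)
      = mfderiv 𝓘(ℝ, EX) 𝓘(ℝ, EX) (A.act g) x := by rw [A.one_act]
  exact (DFunLike.congr_fun e1 _).symm.trans (h3.trans (DFunLike.congr_fun e2 _))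

/-- The momentum map intertwines the infinitesimal actions. -/
theorem dJ_fundamental (x : X) (Y : GroupLieAlgebra 𝓘(ℝ, EG) G) :
    A.dJ x (fundamental A.act x Y) = P.dressing (A.J x) (P.incl Y) := by
  have := contMDiffSMul_quotient G P.submersion
  -- Again one curve computed twice: J(c_t·x) = c_t J(x), with c_t regarded on the right as a curve
  -- in D.
  obtain ⟨c, hc⟩ := exists_hasVelocity (1 : G) Y
  have h1 := (hc.comp (A.smooth_orbit x).contMDiffAt).comp A.smooth_J.contMDiffAt
  have hd : ContMDiff 𝓘(ℝ, ED) 𝓘(ℝ, ES) ∞ (fun d : D => d • A.J x) :=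
    contMDiff_smul.comp (contMDiff_id.prodMk contMDiff_const)
  have h2 := (hc.comp P.smooth_incl.contMDiffAt).comp hd.contMDiffAt
  have h3 := h1.2.2.symm.trans
    ((congrArg (fun L : ℝ → D ⧸ G => (mfderiv 𝓘(ℝ, ℝ) 𝓘(ℝ, ES) L 0 : ℝ →L[ℝ] ES) 1)
      (funext fun t => A.equivariant (c t) x)).trans h2.2.2)
  have e : (mfderiv 𝓘(ℝ, EX) 𝓘(ℝ, ES) A.J (A.act 1 x) : EX →L[ℝ] ES)
      = mfderiv 𝓘(ℝ, EX) 𝓘(ℝ, ES) A.J x := by rw [A.one_act]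
  exact (DFunLike.congr_fun e _).symm.trans h3

/-- The duality that characterises λ, freed from the identification of 𝔤 with its bidual. -/
theorem apply_lam (s : D ⧸ G) (θ : Cotangent 𝓘(ℝ, ES) s)
    (ξ : Module.Dual ℝ (GroupLieAlgebra 𝓘(ℝ, EG) G)) :
    ξ (P.lam s θ) = θ (P.dressing s (P.sharp ξ)) := by
  have : Module.evalEquiv ℝ (GroupLieAlgebra 𝓘(ℝ, EG) G) (P.lam s θ) =
      θ.toLinearMap ∘ₗ P.dressing s ∘ₗ T.𝔥.subtype ∘ₗ P.sharp.toLinearMap :=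
    LinearEquiv.apply_symm_apply _ _
  exact DFunLike.congr_fun this ξ

/-- Converts the mixed term of Π into the term of the momentum condition. Duality of λ makes the
left side the pairing of L_g^*Φ_x^*η with λθ, and equivariance of the orbit map moves L_g over to
Φ_g. -/
theorem apply_dressing_leftSharp (g : G) (x : X) (θ : Cotangent 𝓘(ℝ, ES) (A.J x))
    (η : Cotangent 𝓘(ℝ, EX) (A.act g x)) :
    θ (P.dressing (A.J x) (P.leftSharp g (η.comp (A.dOrbit g x)))) =
      η.comp (A.dTranslation g x) (fundamental A.act x (P.lam (A.J x) θ)) := by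
  refine (apply_lam (A.J x) θ _).symm.trans ?_
  exact congrArg η (A.dOrbit_mul_left g x (P.lam (A.J x) θ))

/-- The graph of the action of `Γ` on `X`. -/
def graph : Set ((G × (D ⧸ G)) × X × X) :=
  {p | p.1.2 = A.J p.2.1 ∧ p.2.2 = A.act p.1.1 p.2.1}

/-- The covectors `(-Φ_x^* η, θ, -J^* θ - Φ_g^* η, η)`, which vanish on the graph of the action. -/
def graphCovector (g : G) (x : X) (θ : Cotangent 𝓘(ℝ, ES) (A.J x))
    (η : Cotangent 𝓘(ℝ, EX) (A.act g x)) :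
    Cotangent ((𝓘(ℝ, EG).prod 𝓘(ℝ, ES)).prod (𝓘(ℝ, EX).prod 𝓘(ℝ, EX)))
      (((g, A.J x), x, A.act g x) : (G × (D ⧸ G)) × X × X) :=
  (((-(η.comp (A.dOrbit g x)) : EG →L[ℝ] ℝ).coprod (θ : ES →L[ℝ] ℝ)).coprod
    ((-(θ.comp (A.dJ x)) - η.comp (A.dTranslation g x) : EX →L[ℝ] ℝ).coprod (η : EX →L[ℝ] ℝ)) :
    (EG × ES) × EX × EX →L[ℝ] ℝ)

/-- Differentiating the two equations of the graph along a curve expresses the D/G-component and the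
last X-component of its velocity through the other two; the four terms of the covector then cancel.
-/
theorem graphCovector_mem_conormal (g : G) (x : X) (θ : Cotangent 𝓘(ℝ, ES) (A.J x))
    (η : Cotangent 𝓘(ℝ, EX) (A.act g x)) :
    A.graphCovector g x θ η ∈ conormal ((𝓘(ℝ, EG).prod 𝓘(ℝ, ES)).prod (𝓘(ℝ, EX).prod 𝓘(ℝ, EX)))
      A.graph (((g, A.J x), x, A.act g x) : (G × (D ⧸ G)) × X × X) := by
  intro c v hc hmem
  have hJ := hc.fst.snd.eq_of_eventuallyEq (hc.snd.fst.comp A.smooth_J.contMDiffAt)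
    (hmem.mono fun t h => h.1)
  have hΦ := hc.snd.snd.eq_of_eventuallyEq
    (HasVelocity.comp₂ (f := A.act) hc.fst.fst hc.snd.fst A.smooth_act.contMDiffAt)
    (hmem.mono fun t h => h.2)
  obtain ⟨⟨v1, v2⟩, w1, w2⟩ : (EG × ES) × EX × EX := v
  change v2 = A.dJ x w1 at hJ
  change w2 = A.dOrbit g x v1 + A.dTranslation g x w1 at hΦ
  subst hJ hΦ
  change (-(η (A.dOrbit g x v1)) + θ (A.dJ x w1)) + ((-(θ (A.dJ x w1)) - η (A.dTranslation g x w1))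
    + η (A.dOrbit g x v1 + A.dTranslation g x w1)) = 0
  rw [map_add]
  ring

/-- A conormal covector vanishes on the image of the derivative of the parametrisation by (g, x), so
its components on D/G and on the last factor X, which become θ and η, determine the other two. -/
theorem exists_graphCovector [IsManifold 𝓘(ℝ, EX) ∞ X] (g : G) (x : X)
    {a : Cotangent ((𝓘(ℝ, EG).prod 𝓘(ℝ, ES)).prod (𝓘(ℝ, EX).prod 𝓘(ℝ, EX)))
      (((g, A.J x), x, A.act g x) : (G × (D ⧸ G)) × X × X)}
    (ha : a ∈ conormal ((𝓘(ℝ, EG).prod 𝓘(ℝ, ES)).prod (𝓘(ℝ, EX).prod 𝓘(ℝ, EX)))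
      A.graph (((g, A.J x), x, A.act g x) : (G × (D ⧸ G)) × X × X)) :
    ∃ θ η, a = A.graphCovector g x θ η := by
  let a' : (EG × ES) × EX × EX →L[ℝ] ℝ := a
  let θ : ES →L[ℝ] ℝ := a'.comp ((ContinuousLinearMap.inl ℝ _ _).comp (ContinuousLinearMap.inr ℝ _ _))
  let η : EX →L[ℝ] ℝ := a'.comp ((ContinuousLinearMap.inr ℝ _ _).comp (ContinuousLinearMap.inr ℝ _ _))
  -- The curves ((c_t, J d_t), d_t, c_t·d_t) lie in the graph and realise every pair (v, w).
  have key : ∀ (v : EG) (w : EX),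
      a' ((v, A.dJ x w), w, A.dOrbit g x v + A.dTranslation g x w) = 0 := by
    intro v w
    obtain ⟨c, hc⟩ := exists_hasVelocity g v
    obtain ⟨d, hd⟩ := exists_hasVelocity x w
    exact ha _ _ ((hc.prodMk (hd.comp A.smooth_J.contMDiffAt)).prodMk
      (hd.prodMk (HasVelocity.comp₂ (f := A.act) hc hd A.smooth_act.contMDiffAt)))
      (Filter.Eventually.of_forall fun t => ⟨rfl, rfl⟩)
  refine ⟨θ, η, ?_⟩
  refine ContinuousLinearMap.ext fun u => ?_
  obtain ⟨⟨v1, v2⟩, w1, w2⟩ : (EG × ES) × EX × EX := u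
  change a' ((v1, v2), w1, w2) = (-(η (A.dOrbit g x v1)) + θ v2) +
    ((-(θ (A.dJ x w1)) - η (A.dTranslation g x w1)) + η w2)
  -- An arbitrary vector is a tangent vector of the graph with the same `v1` and `w1`, plus vectors
  -- in the factor D/G and in the last factor X, where `a'` is θ and η by definition.
  have e : ∀ (j : ES) (b r : EX), (((v1, v2), w1, w2) : (EG × ES) × EX × EX) =
      ((v1, j), w1, b + r)
      + ((((0 : EG), v2), (0 : EX), (0 : EX)) - (((0 : EG), j), (0 : EX), (0 : EX)))
      + (((0, 0), 0, w2) - ((0, 0), 0, b) - ((0, 0), 0, r)) := by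
    intro j b r
    ext <;> simp
  rw [e (A.dJ x w1) (A.dOrbit g x v1) (A.dTranslation g x w1), map_add, map_add, map_sub, map_sub,
    map_sub]
  refine (congrArg (fun t => t + _ + _) (key v1 w1)).trans ?_
  change 0 + (θ v2 - θ (A.dJ x w1)) + (η w2 - η (A.dOrbit g x v1) - η (A.dTranslation g x w1)) = _
  ring

theorem bilin_prod_apply (P : IsGroupPair (EG := EG) (ES := ES) T G)
    (B : BivectorField 𝓘(ℝ, EX) X) (p : (G × (D ⧸ G)) × X × X)
    (a b : Cotangent ((𝓘(ℝ, EG).prod 𝓘(ℝ, ES)).prod (𝓘(ℝ, EX).prod 𝓘(ℝ, EX))) p) :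
    (P.bivector.prod (B.prod B.neg)).bilin p a b =
      P.bivectorG.bilin p.1.1 (covectorFst _ _ _ (covectorFst _ _ _ a))
          (covectorFst _ _ _ (covectorFst _ _ _ b))
        + -P.bivectorQuotient.bilin p.1.2 (covectorSnd _ _ _ (covectorFst _ _ _ a))
          (covectorSnd _ _ _ (covectorFst _ _ _ b))
        + covectorSnd _ _ _ (covectorFst _ _ _ b)
          (P.dressing p.1.2 (P.leftSharp p.1.1 (covectorFst _ _ _ (covectorFst _ _ _ a))))
        - covectorSnd _ _ _ (covectorFst _ _ _ a)
          (P.dressing p.1.2 (P.leftSharp p.1.1 (covectorFst _ _ _ (covectorFst _ _ _ b))))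
        + (B.bilin p.2.1 (covectorFst _ _ _ (covectorSnd _ _ _ a))
            (covectorFst _ _ _ (covectorSnd _ _ _ b))
          + -B.bilin p.2.2 (covectorSnd _ _ _ (covectorSnd _ _ _ a))
            (covectorSnd _ _ _ (covectorSnd _ _ _ b))) :=
  rfl

/-- The value of `Π ⊕ Π_X ⊕ -Π_X` on covectors that vanish on the graph. -/
theorem bilin_graphCovector (B : BivectorField 𝓘(ℝ, EX) X) (g : G) (x : X)
    (θ θ' : Cotangent 𝓘(ℝ, ES) (A.J x)) (η η' : Cotangent 𝓘(ℝ, EX) (A.act g x)) :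
    (P.bivector.prod (B.prod B.neg)).bilin ((g, A.J x), x, A.act g x)
        (A.graphCovector g x θ η) (A.graphCovector g x θ' η') =
      (P.bivectorG.bilin g (η.comp (A.dOrbit g x)) (η'.comp (A.dOrbit g x))
        + B.bilin x (η.comp (A.dTranslation g x)) (η'.comp (A.dTranslation g x))
        - B.bilin (A.act g x) η η')
      + (B.bilin x (θ.comp (A.dJ x)) (θ'.comp (A.dJ x)) - P.bivectorQuotient.bilin (A.J x) θ θ')
      + (B.bilin x (θ.comp (A.dJ x)) (η'.comp (A.dTranslation g x))
        + η'.comp (A.dTranslation g x) (fundamental A.act x (P.lam (A.J x) θ)))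
      - (B.bilin x (θ'.comp (A.dJ x)) (η.comp (A.dTranslation g x))
        + η.comp (A.dTranslation g x) (fundamental A.act x (P.lam (A.J x) θ'))) := by
  -- Each component is read off on vectors with a single nonzero entry; `z1` to `z5` remove the
  -- other terms.
  have hcov : ∀ (θ : Cotangent 𝓘(ℝ, ES) (A.J x)) (η : Cotangent 𝓘(ℝ, EX) (A.act g x)),
      (covectorFst _ _ _ (covectorFst _ _ _ (A.graphCovector g x θ η)) = -(η.comp (A.dOrbit g x)))
      ∧ (covectorSnd _ _ _ (covectorFst _ _ _ (A.graphCovector g x θ η)) = θ)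
      ∧ (covectorFst _ _ _ (covectorSnd _ _ _ (A.graphCovector g x θ η))
        = -(θ.comp (A.dJ x)) - η.comp (A.dTranslation g x))
      ∧ (covectorSnd _ _ _ (covectorSnd _ _ _ (A.graphCovector g x θ η)) = η) := by
    intro θ η
    let L : (EG × ES) × EX × EX →L[ℝ] ℝ := A.graphCovector g x θ η
    have hL : ∀ v1 v2 w1 w2, L ((v1, v2), w1, w2) = (-(η (A.dOrbit g x v1)) + θ v2) +
      ((-(θ (A.dJ x w1)) - η (A.dTranslation g x w1)) + η w2) := fun _ _ _ _ => rfl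
    have z1 : η (A.dOrbit g x (0 : EG)) = 0 := (congrArg η (map_zero (A.dOrbit g x))).trans (map_zero η)
    have z2 : θ (0 : ES) = 0 := map_zero θ
    have z3 : θ (A.dJ x (0 : EX)) = 0 := (congrArg θ (map_zero (A.dJ x))).trans (map_zero θ)
    have z4 : η (A.dTranslation g x (0 : EX)) = 0 :=
      (congrArg η (map_zero (A.dTranslation g x))).trans (map_zero η)
    have z5 : η (0 : EX) = 0 := map_zero η
    refine ⟨?_, ?_, ?_, ?_⟩ <;> refine ContinuousLinearMap.ext fun v => ?_
    · refine (hL v 0 0 0).trans ?_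
      change _ = -(η (A.dOrbit g x v))
      rw [z2, z3, z4, z5]
      ring
    · refine (hL 0 v 0 0).trans ?_
      rw [z1, z3, z4, z5]
      ring
    · refine (hL 0 0 v 0).trans ?_
      change _ = -(θ (A.dJ x v)) - η (A.dTranslation g x v)
      rw [z1, z2, z5]
      ring
    · refine (hL 0 0 0 v).trans ?_
      rw [z1, z2, z3, z4]
      ring
  obtain ⟨h1, h2, h3, h4⟩ := hcov θ η
  obtain ⟨h1', h2', h3', h4'⟩ := hcov θ' η'
  have hm := A.apply_dressing_leftSharp g x θ η'
  have hm' := A.apply_dressing_leftSharp g x θ' η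
  -- Brings J^*θ' into the first slot, where the momentum condition applies.
  have hB : B.bilin x (η.comp (A.dTranslation g x)) (θ'.comp (A.dJ x)) =
      -B.bilin x (θ'.comp (A.dJ x)) (η.comp (A.dTranslation g x)) :=
    (LinearMap.IsAlt.neg (B.isAlt x) _ _).symm
  rw [bilin_prod_apply, h1, h2, h3, h4, h1', h2', h3', h4']
  simp only [map_neg, map_sub, LinearMap.neg_apply, LinearMap.sub_apply, hm, hm', hB]
  ring

end EquivariantAction

end Correspondence

/-! ### Velocity of the inverse of a curve acting on a point -/

section Fundamental

variable {EK : Type*} [NormedAddCommGroup EK] [NormedSpace ℝ EK] [FiniteDimensional ℝ EK]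
  {K : Type*} [TopologicalSpace K] [ChartedSpace EK K] [Group K] [LieGroup 𝓘(ℝ, EK) ∞ K]
  {EY : Type*} [NormedAddCommGroup EY] [NormedSpace ℝ EY]
  {Y : Type*} [TopologicalSpace Y] [ChartedSpace EY Y]

theorem HasVelocity.of_eq {E : Type*} [NormedAddCommGroup E] [NormedSpace ℝ E]
    {H : Type*} [TopologicalSpace H] {I : ModelWithCorners ℝ E H}
    {M : Type*} [TopologicalSpace M] [ChartedSpace H M] {c : ℝ → M} {p q : M} {v : E}
    (h : HasVelocity I c p v) (hpq : p = q) : HasVelocity I c q v := by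
  subst hpq
  exact h

/-- If `c` has velocity `v` at `1`, then `c⁻¹ · y` has velocity `- v̂ (y)`. -/
theorem HasVelocity.inv_act {act : K → Y → Y} (one_act : ∀ y, act 1 y = y)
    (mul_act : ∀ g h y, act (g * h) y = act g (act h y))
    (smooth_act : ContMDiff (𝓘(ℝ, EK).prod 𝓘(ℝ, EY)) 𝓘(ℝ, EY) ∞ (fun p : K × Y => act p.1 p.2))
    {c : ℝ → K} {v : GroupLieAlgebra 𝓘(ℝ, EK) K} (hc : HasVelocity 𝓘(ℝ, EK) c 1 v) (y : Y) :
    HasVelocity 𝓘(ℝ, EY) (fun t => act (c t)⁻¹ y) y (-(fundamental act y : EK →L[ℝ] EY) v) := by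
  have hi : ContMDiff 𝓘(ℝ, EK) 𝓘(ℝ, EY) ∞ (fun k : K => act k⁻¹ y) :=
    smooth_act.comp ((contMDiff_inv 𝓘(ℝ, EK) ∞).prodMk contMDiff_const)
  have hd := (hc.comp hi.contMDiffAt).of_eq (q := y) (by simp [one_act])
  -- The unknown velocity u of c_t⁻¹·y: as c_t·(c_t⁻¹·y) = y is constant, the sum rule gives v̂(y) +
  -- u = 0.
  set u : EY := mfderiv 𝓘(ℝ, EK) 𝓘(ℝ, EY) (fun k : K => act k⁻¹ y) 1 v
  have h1 := (HasVelocity.comp₂ hc hd (f := act) smooth_act.contMDiffAt).of_eq (one_act y)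
  have h2 := (h1.eq_of_eventuallyEq (HasVelocity.const y)
    (Filter.Eventually.of_forall fun t => by simp [← mul_act, one_act]))
  have e : (mfderiv 𝓘(ℝ, EY) 𝓘(ℝ, EY) (act 1) y : EY →L[ℝ] EY) = ContinuousLinearMap.id ℝ EY := by
    rw [show act 1 = id from funext one_act]
    exact mfderiv_id
  let F : EK →L[ℝ] EY := fundamental act y
  have h3 : F v + u = 0 := (congrArg (fun L : EY →L[ℝ] EY => F v + L u) e).symm.trans h2
  have h4 : u = -F v := (neg_eq_of_add_eq_zero_right h3).symm
  change HasVelocity 𝓘(ℝ, EY) _ y (-F v)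
  rw [← h4]
  exact hd

end Fundamental

/-! ### The Lie algebroid of an action groupoid -/

section ActionGroupoid

variable {EK : Type*} [NormedAddCommGroup EK] [NormedSpace ℝ EK] [FiniteDimensional ℝ EK]
  {K : Type*} [TopologicalSpace K] [ChartedSpace EK K] [Group K] [LieGroup 𝓘(ℝ, EK) ∞ K]
  {EY : Type*} [NormedAddCommGroup EY] [NormedSpace ℝ EY] [FiniteDimensional ℝ EY]
  {Y : Type*} [TopologicalSpace Y] [ChartedSpace EY Y]
  [MulAction K Y] [ContMDiffSMul 𝓘(ℝ, EK) 𝓘(ℝ, EY) ∞ K Y]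

/-- The vectors tangent to the fibre of `α` at the unit `(1, y)` have the form
`(X, - X̂ (y))`. -/
theorem snd_eq_of_mem_algebroid {y : Y} {u : EK × EY}
    (hu : u ∈ (actionGroupoid (EK := EK) (EY := EY) K Y).algebroid y) :
    u.2 = -(fundamental (fun (k : K) (y : Y) => k • y) y : EK →L[ℝ] EY) u.1 := by
  let F : EK →L[ℝ] EY := fundamental (fun (k : K) (y : Y) => k • y) y
  -- Subtracting the known element with the same first entry leaves some (0, w) in ker dα. Since 1
  -- acts as the identity, dα(0, w) = w, so w = 0.
  have h1 : u - (u.1, -F u.1) ∈ (actionGroupoid (EK := EK) (EY := EY) K Y).algebroid y :=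
    Submodule.sub_mem _ hu (toAlgebroid_aux K Y y u.1)
  have hf : MDifferentiableAt (𝓘(ℝ, EK).prod 𝓘(ℝ, EY)) 𝓘(ℝ, EY)
      (fun q : K × Y => q.1 • q.2) (1, y) :=
    (contMDiff_smul (n := ∞)).mdifferentiableAt (by simp)
  have e : (mfderiv 𝓘(ℝ, EY) 𝓘(ℝ, EY) (fun z : Y => (1 : K) • z) y : EY →L[ℝ] EY)
      = ContinuousLinearMap.id ℝ EY := by
    rw [show (fun z : Y => (1 : K) • z) = id from funext (one_smul K)]
    exact mfderiv_id
  have h2 : ∀ w : EY, ((0, w) : EK × EY) ∈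
      (actionGroupoid (EK := EK) (EY := EY) K Y).algebroid y → w = 0 := by
    intro w hw
    have h := mfderiv_prod_eq_add_apply
      (v := ((0, w) : TangentSpace (𝓘(ℝ, EK).prod 𝓘(ℝ, EY)) ((1 : K), y))) hf
    have h' : (mfderiv 𝓘(ℝ, EK) 𝓘(ℝ, EY) (fun k : K => k • y) 1 : EK →L[ℝ] EY) 0
        + (mfderiv 𝓘(ℝ, EY) 𝓘(ℝ, EY) (fun z : Y => (1 : K) • z) y : EY →L[ℝ] EY) w = 0 :=
      h.symm.trans hw
    rw [e, map_zero, zero_add] at h'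
    exact h'
  change u.2 = -F u.1
  refine sub_eq_zero.1 (h2 _ ?_)
  have : ((0, u.2 - -F u.1) : EK × EY) = u - (u.1, -F u.1) := Prod.ext (sub_self u.1).symm rfl
  rw [this]
  exact h1

end ActionGroupoid

/-! ### Coisotropy of the graph and the momentum condition -/

section Correspondence

variable {ED : Type*} [NormedAddCommGroup ED] [NormedSpace ℝ ED] [FiniteDimensional ℝ ED]
  {D : Type*} [TopologicalSpace D] [ChartedSpace ED D] [Group D] [LieGroup 𝓘(ℝ, ED) ∞ D]
  {EG : Type*} [NormedAddCommGroup EG] [NormedSpace ℝ EG] [FiniteDimensional ℝ EG]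
  {ES : Type*} [NormedAddCommGroup ES] [NormedSpace ℝ ES] [FiniteDimensional ℝ ES]
  {T : ManinQuasiTriple (GroupLieAlgebra 𝓘(ℝ, ED) D)} {G : Subgroup D}
  [ChartedSpace EG G] [LieGroup 𝓘(ℝ, EG) ∞ G] [ChartedSpace ES (D ⧸ G)]
  {P : IsGroupPair (EG := EG) (ES := ES) T G}
  {EX : Type*} [NormedAddCommGroup EX] [NormedSpace ℝ EX]
  {X : Type*} [TopologicalSpace X] [ChartedSpace EX X]

namespace EquivariantAction

variable (A : EquivariantAction P EX X)

theorem dTranslation_one (x : X) (w : EX) : A.dTranslation 1 x w = w := by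
  have e : (mfderiv 𝓘(ℝ, EX) 𝓘(ℝ, EX) (A.act 1) x : EX →L[ℝ] EX) = ContinuousLinearMap.id ℝ EX := by
    rw [show A.act 1 = id from funext A.one_act]
    exact mfderiv_id
  exact DFunLike.congr_fun e w

/-- The derivative of Φ is the sum of its partial derivatives, so Φ^*η has components Φ_x^*η and
Φ_g^*η, and a product bivector has no cross terms. -/
theorem mapsTo_iff (B : BivectorField 𝓘(ℝ, EX) X) :
    (P.bivectorG.prod B).MapsTo B (fun p : G × X => A.act p.1 p.2) ↔
      ∀ g x (η η' : Cotangent 𝓘(ℝ, EX) (A.act g x)),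
        P.bivectorG.bilin g (η.comp (A.dOrbit g x)) (η'.comp (A.dOrbit g x))
          + B.bilin x (η.comp (A.dTranslation g x)) (η'.comp (A.dTranslation g x))
          = B.bilin (A.act g x) η η' := by
  have h1 : ∀ g x (η : Cotangent 𝓘(ℝ, EX) (A.act g x)),
      covectorFst _ _ (g, x) (η.comp (mfderiv (𝓘(ℝ, EG).prod 𝓘(ℝ, EX)) 𝓘(ℝ, EX)
        (fun p : G × X => A.act p.1 p.2) (g, x))) = η.comp (A.dOrbit g x) := by
    intro g x η
    refine ContinuousLinearMap.ext fun v => congrArg η ((A.mfderiv_act g x (v, 0)).trans ?_)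
    exact (congrArg (A.dOrbit g x v + ·) (map_zero (A.dTranslation g x))).trans (add_zero _)
  have h2 : ∀ g x (η : Cotangent 𝓘(ℝ, EX) (A.act g x)),
      covectorSnd _ _ (g, x) (η.comp (mfderiv (𝓘(ℝ, EG).prod 𝓘(ℝ, EX)) 𝓘(ℝ, EX)
        (fun p : G × X => A.act p.1 p.2) (g, x))) = η.comp (A.dTranslation g x) := by
    intro g x η
    refine ContinuousLinearMap.ext fun v => congrArg η ((A.mfderiv_act g x (0, v)).trans ?_)
    exact (congrArg (· + A.dTranslation g x v) (map_zero (A.dOrbit g x))).trans (zero_add _)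
  have h3 : ∀ g x (η η' : Cotangent 𝓘(ℝ, EX) (A.act g x)),
      (P.bivectorG.prod B).bilin (g, x)
        (η.comp (mfderiv (𝓘(ℝ, EG).prod 𝓘(ℝ, EX)) 𝓘(ℝ, EX)
          (fun p : G × X => A.act p.1 p.2) (g, x)))
        (η'.comp (mfderiv (𝓘(ℝ, EG).prod 𝓘(ℝ, EX)) 𝓘(ℝ, EX)
          (fun p : G × X => A.act p.1 p.2) (g, x))) =
      P.bivectorG.bilin g (η.comp (A.dOrbit g x)) (η'.comp (A.dOrbit g x))
          + B.bilin x (η.comp (A.dTranslation g x)) (η'.comp (A.dTranslation g x)) := by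
    intro g x η η'
    rw [← h1, ← h1, ← h2, ← h2]
    rfl
  constructor
  · intro h g x η η'
    exact (h3 g x η η').symm.trans (h (g, x) η η')
  · rintro h ⟨g, x⟩ η η'
    exact (h3 g x η η').trans (h g x η η')

/-- By skew-symmetry of `Π_X` the momentum map condition makes `J` a bivector map. -/
theorem bilin_pullback_J {B : BivectorField 𝓘(ℝ, EX) X} {x : X}
    (h : ∀ (θ : Cotangent 𝓘(ℝ, ES) (A.J x)) (ζ : Cotangent 𝓘(ℝ, EX) x),
      B.bilin x (θ.comp (A.dJ x)) ζ = -ζ (fundamental A.act x (P.lam (A.J x) θ)))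
    (θ θ' : Cotangent 𝓘(ℝ, ES) (A.J x)) :
    B.bilin x (θ.comp (A.dJ x)) (θ'.comp (A.dJ x)) = P.bivectorQuotient.bilin (A.J x) θ θ' := by
  -- Equivariance of J turns (λθ)_X into a dressing vector. The left side is skew because Π_X is, so
  -- averaging over both orders yields Π_{D/G} in its skew-symmetrised form.
  have key : ∀ θ θ' : Cotangent 𝓘(ℝ, ES) (A.J x),
      B.bilin x (θ.comp (A.dJ x)) (θ'.comp (A.dJ x)) = -P.dressingForm (A.J x) θ θ' :=
    fun θ θ' => (h θ _).trans (congrArg (fun u => -θ' u) (A.dJ_fundamental x _))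
  have h1 : -B.bilin x (θ.comp (A.dJ x)) (θ'.comp (A.dJ x)) =
      B.bilin x (θ'.comp (A.dJ x)) (θ.comp (A.dJ x)) := LinearMap.IsAlt.neg (B.isAlt x) _ _
  have h2 : P.bivectorQuotient.bilin (A.J x) θ θ' =
      (1 / 2 : ℝ) * (P.dressingForm (A.J x) θ' θ - P.dressingForm (A.J x) θ θ') := rfl
  have h3 := key θ θ'
  have h4 := key θ' θ
  rw [h2]
  linarith

/-- The graph of the action is coisotropic if and only if the action preserves the bivector fields
and `J` is a momentum map. -/
theorem isCoisotropic_graph_iff [IsManifold 𝓘(ℝ, EX) ∞ X] (B : BivectorField 𝓘(ℝ, EX) X) :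
    IsCoisotropic (P.bivector.prod (B.prod B.neg)) A.graph ↔
      (P.bivectorG.prod B).MapsTo B (fun p : G × X => A.act p.1 p.2) ∧
      ∀ x (θ : Cotangent 𝓘(ℝ, ES) (A.J x)) (ζ : Cotangent 𝓘(ℝ, EX) x),
        B.bilin x (θ.comp (A.dJ x)) ζ = -ζ (fundamental A.act x (P.lam (A.J x) θ)) := by
  rw [mapsTo_iff]
  constructor
  · intro h
    have h' := fun g x θ θ' η η' => (A.bilin_graphCovector B g x θ θ' η η').symm.trans
      (h ((g, A.J x), x, A.act g x) ⟨rfl, rfl⟩ _ (A.graphCovector_mem_conormal g x θ η)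
        _ (A.graphCovector_mem_conormal g x θ' η'))
    refine ⟨fun g x η η' => ?_, fun x θ ζ => ?_⟩
    · have := h' g x 0 0 η η'
      simp only [ContinuousLinearMap.zero_comp, map_zero, LinearMap.zero_apply] at this
      linarith
    · let η' : Cotangent 𝓘(ℝ, EX) (A.act 1 x) := (ζ : EX →L[ℝ] ℝ)
      have hζ : η'.comp (A.dTranslation 1 x) = ζ :=
        ContinuousLinearMap.ext fun w => congrArg (ζ : EX →L[ℝ] ℝ) (A.dTranslation_one x w)
      have := h' 1 x θ 0 0 η'
      rw [hζ] at this
      simp only [ContinuousLinearMap.zero_comp, map_zero, LinearMap.zero_apply] at this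
      linarith
  · rintro ⟨h1, h2⟩ ⟨⟨g, s⟩, x, y⟩ ⟨hs, hy⟩
    change s = A.J x at hs
    change y = A.act g x at hy
    subst hs hy
    intro a ha b hb
    obtain ⟨θ, η, rfl⟩ := A.exists_graphCovector g x ha
    obtain ⟨θ', η', rfl⟩ := A.exists_graphCovector g x hb
    rw [bilin_graphCovector, h1, A.bilin_pullback_J (h2 x), h2, h2]
    ring

/-- The space over the action groupoid given by an equivariant action. -/
def toGroupoidSpace : GroupoidSpace 𝓘(ℝ, EX) X P.groupoid where
  J := A.J
  act γ x _ := A.act γ.1 x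
  smooth_J := A.smooth_J
  smooth_act _ := ⟨Set.univ, isOpen_univ, trivial, fun p => A.act p.1.1 p.2,
    (A.smooth_act.comp ((contMDiff_fst.comp contMDiff_fst).prodMk contMDiff_snd)).contMDiffOn,
    fun _ _ => rfl⟩
  J_act γ x h := (A.equivariant γ.1 x).trans (congrArg (γ.1 • ·) (Eq.symm h))
  mul_act γ γ' x _ _ := A.mul_act γ.1 γ'.1 x
  unit_act := A.one_act

end EquivariantAction

/-! ### Spaces over the action groupoid as equivariant actions -/

namespace GroupoidSpace

variable (S : GroupoidSpace 𝓘(ℝ, EX) X P.groupoid)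

/-- Composability forces the second entry of γ to be J(x), so the action of Γ carries no more data
than a map G × X → X. -/
theorem act_eq (γ : G × (D ⧸ G)) (x : X) (h : P.groupoid.β γ = S.J x) :
    S.act γ x h = S.act (γ.1, S.J x) x rfl := by
  obtain ⟨g, s⟩ := γ
  change s = S.J x at h
  subst h
  rfl

/-- The action `g · x = (g, J x) · x` given by a space over the action groupoid. -/
def toEquivariantAction : EquivariantAction P EX X where
  act g x := S.act (g, S.J x) x rfl
  one_act := S.unit_act
  mul_act g h x :=
    -- In Γ, (g h, J x) = (g, h J x)(h, J x); `act_eq` then replaces h J x by J(h·x).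
    (S.mul_act (g, h • S.J x) (h, S.J x) x rfl rfl).trans (S.act_eq _ _ _)
  smooth_act p := by
    -- Smoothness on the fibre product means a local smooth extension F; composed with the smooth
    -- map (g, x) ↦ ((g, J x), x) into the fibre product, it is the action near p.
    obtain ⟨U, hU, hp, F, hF, hFS⟩ := S.smooth_act ⟨((p.1, S.J p.2), p.2), rfl⟩
    have hι : ContMDiff (𝓘(ℝ, EG).prod 𝓘(ℝ, EX)) ((𝓘(ℝ, EG).prod 𝓘(ℝ, ES)).prod 𝓘(ℝ, EX)) ∞
        (fun q : G × X => ((q.1, S.J q.2), q.2)) :=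
      (contMDiff_fst.prodMk (S.smooth_J.comp contMDiff_snd)).prodMk contMDiff_snd
    have h := ContMDiffAt.comp p (hF.contMDiffAt (hU.mem_nhds hp)) hι.contMDiffAt
    refine h.congr_of_eventuallyEq ?_
    filter_upwards [hι.continuous.continuousAt.eventually (hU.mem_nhds hp)] with q hq
    exact (hFS ⟨((q.1, S.J q.2), q.2), rfl⟩ hq).symm
  J := S.J
  smooth_J := S.smooth_J
  equivariant g x := S.J_act (g, S.J x) x rfl

theorem graph_eq : {p : (G × (D ⧸ G)) × X × X | ∃ h : P.groupoid.β p.1 = S.J p.2.1,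
    p.2.2 = S.act p.1 p.2.1 h} = S.toEquivariantAction.graph := by
  ext p
  constructor
  · rintro ⟨h, h'⟩
    exact ⟨h, h'.trans (S.act_eq _ _ h)⟩
  · rintro ⟨h, h'⟩
    exact ⟨h, h'.trans (S.act_eq _ _ h).symm⟩

/-- The infinitesimal action of the Lie algebroid is `(Y, - Ŷ (J x)) ↦ - Y_X (x)`. -/
theorem isInfinitesimalAction_iff
    (ρ : ∀ x : X, P.groupoid.algebroid (S.J x) →ₗ[ℝ] TangentSpace 𝓘(ℝ, EX) x) :
    S.IsInfinitesimalAction ρ ↔ ∀ x (u : P.groupoid.algebroid (S.J x)),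
      ρ x u = -(fundamental S.toEquivariantAction.act x : EG →L[ℝ] EX) (u.1 : EG × ES).1 := by
  have := P.contMDiffSMul
  -- In (g_t, s_t)⁻¹·x only g_t⁻¹ acts, so the curve g_t alone determines the velocity.
  have key : ∀ (x : X) (u : P.groupoid.algebroid (S.J x)) (γ : ℝ → G × (D ⧸ G))
      (hγ : ∀ t, P.groupoid.α (γ t) = S.J x),
      HasVelocity (𝓘(ℝ, EG).prod 𝓘(ℝ, ES)) γ (P.groupoid.unit (S.J x)) u →
      HasVelocity 𝓘(ℝ, EX) (fun t => S.act (P.groupoid.inv (γ t)) x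
        ((P.groupoid.β_inv (γ t)).trans (hγ t))) x
        (-(fundamental S.toEquivariantAction.act x : EG →L[ℝ] EX) (u.1 : EG × ES).1) := by
    intro x u γ hγ hu
    have h1 := HasVelocity.inv_act S.toEquivariantAction.one_act S.toEquivariantAction.mul_act
      S.toEquivariantAction.smooth_act hu.fst x
    rwa [show (fun t => S.act (P.groupoid.inv (γ t)) x ((P.groupoid.β_inv (γ t)).trans (hγ t))) =
      fun t => S.toEquivariantAction.act (γ t).1⁻¹ x from funext fun t => S.act_eq _ _ _]
  constructor
  · intro h x u
    -- The definition of ρ speaks of curves in the α-fibre, so one with velocity u is needed: (c_t,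
    -- c_t⁻¹ J x), where c has velocity Y, the 𝔤-part of u. Its second velocity is -Ŷ(J x), as
    -- membership in A requires.
    obtain ⟨c, hc⟩ := exists_hasVelocity (1 : G) (u.1 : EG × ES).1
    have hs := HasVelocity.inv_act (act := fun (g : G) (s : D ⧸ G) => g • s) (one_smul G)
      mul_smul (contMDiff_smul (I := 𝓘(ℝ, EG)) (I' := 𝓘(ℝ, ES)) (n := ∞)) hc (S.J x)
    have hu := snd_eq_of_mem_algebroid (K := G) (Y := D ⧸ G) u.2
    have hγ := hc.prodMk hs
    have hα : ∀ t, P.groupoid.α (c t, (c t)⁻¹ • S.J x) = S.J x := fun t =>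
      smul_inv_smul (c t) (S.J x)
    have hγ' : HasVelocity (𝓘(ℝ, EG).prod 𝓘(ℝ, ES)) (fun t => (c t, (c t)⁻¹ • S.J x))
        (P.groupoid.unit (S.J x)) u := by
      have e : (u.1 : EG × ES) = ((u.1 : EG × ES).1,
        -(fundamental (fun (g : G) (s : D ⧸ G) => g • s) (S.J x) : EG →L[ℝ] ES)
          (u.1 : EG × ES).1) := Prod.ext rfl hu
      rw [e]
      exact hγ
    exact (h x u _ hα hγ').unique (key x u _ hα hγ')
  · intro h x u γ hγ hu
    rw [h]
    exact key x u γ hγ hu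

theorem trivector_apply [ContMDiffSMul 𝓘(ℝ, EG) 𝓘(ℝ, ES) ∞ G (D ⧸ G)] (s : D ⧸ G)
    (m : Fin 3 → Module.Dual ℝ (P.groupoid.algebroid s)) :
    P.trivector s m = P.φ (fun i => (toAlgebroid G (D ⧸ G) s).dualMap (m i)) :=
  rfl

/-- The trivector field on `X` induced by the constant section `φ` is `φ_X`. -/
theorem exists_isInfinitesimalAction_iff (Q : (X → ℝ) → (X → ℝ) → (X → ℝ) → X → ℝ) :
    (∃ ρ : ∀ x : X, P.groupoid.algebroid (S.J x) →ₗ[ℝ] TangentSpace 𝓘(ℝ, EX) x,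
      S.IsInfinitesimalAction ρ ∧
      ∀ f g h : X → ℝ, ContMDiff 𝓘(ℝ, EX) 𝓘(ℝ, ℝ) ∞ f → ContMDiff 𝓘(ℝ, EX) 𝓘(ℝ, ℝ) ∞ g →
        ContMDiff 𝓘(ℝ, EX) 𝓘(ℝ, ℝ) ∞ h → ∀ x, Q f g h x =
          P.trivector (S.J x) ![(differential 𝓘(ℝ, EX) f x).toLinearMap ∘ₗ ρ x,
            (differential 𝓘(ℝ, EX) g x).toLinearMap ∘ₗ ρ x,
            (differential 𝓘(ℝ, EX) h x).toLinearMap ∘ₗ ρ x]) ↔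
    ∀ f g h : X → ℝ, ContMDiff 𝓘(ℝ, EX) 𝓘(ℝ, ℝ) ∞ f → ContMDiff 𝓘(ℝ, EX) 𝓘(ℝ, ℝ) ∞ g →
      ContMDiff 𝓘(ℝ, EX) 𝓘(ℝ, ℝ) ∞ h → ∀ x, Q f g h x =
        P.φ ![(differential 𝓘(ℝ, EX) f x).toLinearMap ∘ₗ
            (-(fundamental S.toEquivariantAction.act x)).toLinearMap,
          (differential 𝓘(ℝ, EX) g x).toLinearMap ∘ₗ
            (-(fundamental S.toEquivariantAction.act x)).toLinearMap,
          (differential 𝓘(ℝ, EX) h x).toLinearMap ∘ₗ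
            (-(fundamental S.toEquivariantAction.act x)).toLinearMap] := by
  have key : ∀ ρ : ∀ x : X, P.groupoid.algebroid (S.J x) →ₗ[ℝ] TangentSpace 𝓘(ℝ, EX) x,
      S.IsInfinitesimalAction ρ → ∀ x (a b c : Cotangent 𝓘(ℝ, EX) x),
      P.trivector (S.J x) ![a.toLinearMap ∘ₗ ρ x, b.toLinearMap ∘ₗ ρ x, c.toLinearMap ∘ₗ ρ x] =
      P.φ ![a.toLinearMap ∘ₗ (-(fundamental S.toEquivariantAction.act x)).toLinearMap,
        b.toLinearMap ∘ₗ (-(fundamental S.toEquivariantAction.act x)).toLinearMap,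
        c.toLinearMap ∘ₗ (-(fundamental S.toEquivariantAction.act x)).toLinearMap] := by
    intro ρ hρ x a b c
    have := P.contMDiffSMul
    rw [isInfinitesimalAction_iff] at hρ
    -- `toAlgebroid` sends v to a vector with first entry v, on which ρ takes the value -v_X.
    have e : ∀ a : Cotangent 𝓘(ℝ, EX) x,
        (toAlgebroid G (D ⧸ G) (S.J x)).dualMap (a.toLinearMap ∘ₗ ρ x) =
          a.toLinearMap ∘ₗ (-(fundamental S.toEquivariantAction.act x)).toLinearMap := fun a =>
      LinearMap.ext fun v => congrArg a (hρ x (toAlgebroid G (D ⧸ G) (S.J x) v))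
    refine (trivector_apply (S.J x) _).trans (congrArg P.φ (funext fun i => ?_))
    fin_cases i
    exacts [e a, e b, e c]
  constructor
  · rintro ⟨ρ, hρ, H⟩ f g h hf hg hh x
    exact (H f g h hf hg hh x).trans (key ρ hρ x _ _ _)
  · intro H
    -- The only possible infinitesimal action: project A to 𝔤 and apply Y ↦ -Y_X.
    let ρ : ∀ x : X, P.groupoid.algebroid (S.J x) →ₗ[ℝ] TangentSpace 𝓘(ℝ, EX) x := fun x =>
      (-(fundamental S.toEquivariantAction.act x : EG →L[ℝ] EX)).toLinearMap ∘ₗ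
        LinearMap.fst ℝ EG ES ∘ₗ (P.groupoid.algebroid (S.J x)).subtype
    have hρ : S.IsInfinitesimalAction ρ := (S.isInfinitesimalAction_iff ρ).2 fun x u => rfl
    exact ⟨ρ, hρ, fun f g h hf hg hh x =>
      (H f g h hf hg hh x).trans (key ρ hρ x _ _ _).symm⟩

end GroupoidSpace

/-! ### The two constructions and the bijection -/

variable [FiniteDimensional ℝ EX] [IsManifold 𝓘(ℝ, EX) ∞ X]

/-- The quasi-Poisson space given by a Hamiltonian space over the action groupoid. -/
def HamiltonianSpace.toQuasiPoissonSpace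
    (S : HamiltonianSpace 𝓘(ℝ, EX) X P.groupoid P.bivector P.trivector) :
    QuasiPoissonSpace P EX X :=
  have h := (S.toEquivariantAction.isCoisotropic_graph_iff S.bivector).1
    (S.graph_eq ▸ S.coisotropic)
  { act := S.toEquivariantAction.act
    one_act := S.toEquivariantAction.one_act
    mul_act := S.toEquivariantAction.mul_act
    smooth_act := S.toEquivariantAction.smooth_act
    J := S.J
    smooth_J := S.smooth_J
    equivariant := S.toEquivariantAction.equivariant
    bivector := S.bivector
    smooth_bivector := S.smooth_bivector
    mapsTo_act := h.1
    half_schouten := (S.exists_isInfinitesimalAction_iff _).1 S.half_schouten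
    momentum := h.2 }

/-- The action and the momentum map of a quasi-Poisson space. -/
def QuasiPoissonSpace.toEquivariantAction (Q : QuasiPoissonSpace P EX X) :
    EquivariantAction P EX X where
  act := Q.act
  one_act := Q.one_act
  mul_act := Q.mul_act
  smooth_act := Q.smooth_act
  J := Q.J
  smooth_J := Q.smooth_J
  equivariant := Q.equivariant

/-- The Hamiltonian space over the action groupoid given by a quasi-Poisson space. -/
def QuasiPoissonSpace.toHamiltonianSpace (Q : QuasiPoissonSpace P EX X) :
    HamiltonianSpace 𝓘(ℝ, EX) X P.groupoid P.bivector P.trivector where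
  toGroupoidSpace := Q.toEquivariantAction.toGroupoidSpace
  bivector := Q.bivector
  smooth_bivector := Q.smooth_bivector
  coisotropic := by
    rw [Q.toEquivariantAction.toGroupoidSpace.graph_eq]
    exact (Q.toEquivariantAction.isCoisotropic_graph_iff Q.bivector).2 ⟨Q.mapsTo_act, Q.momentum⟩
  half_schouten :=
    (Q.toEquivariantAction.toGroupoidSpace.exists_isInfinitesimalAction_iff _).2 Q.half_schouten

/-- The one round trip that is not definitional: at (g, s) the action was replaced by the one at (g,
J x), which agrees because s = J x. -/
theorem GroupoidSpace.toGroupoidSpace_toEquivariantAction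
    (S : GroupoidSpace 𝓘(ℝ, EX) X P.groupoid) : S.toEquivariantAction.toGroupoidSpace = S :=
  GroupoidSpace.ext rfl (heq_of_eq (funext fun γ => funext fun x => funext fun h =>
    (S.act_eq γ x h).symm))

/-- Hamiltonian spaces over `G × D/G ⇉ D/G` are the same as quasi-Poisson spaces with
`D/G`-valued momentum map. -/
def hamiltonianEquivQuasiPoisson :
    HamiltonianSpace 𝓘(ℝ, EX) X P.groupoid P.bivector P.trivector ≃ QuasiPoissonSpace P EX X where
  toFun := HamiltonianSpace.toQuasiPoissonSpace
  invFun := QuasiPoissonSpace.toHamiltonianSpace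
  left_inv S := by
    -- Π_X is unchanged and the remaining fields are proofs, so only the equality of groupoid spaces
    -- matters.
    obtain ⟨S, B, _, _, _⟩ := S
    have h := S.toGroupoidSpace_toEquivariantAction
    change (⟨S.toEquivariantAction.toGroupoidSpace, B, _, _, _⟩ :
      HamiltonianSpace 𝓘(ℝ, EX) X P.groupoid P.bivector P.trivector) = _
    congr
  right_inv _ := rfl

end Correspondence

end QuasiPoisson

end

theorem mainTheorem8
    {ED : Type*} [NormedAddCommGroup ED] [NormedSpace ℝ ED] [FiniteDimensional ℝ ED]
    {D : Type*} [TopologicalSpace D] [ChartedSpace ED D] [Group D] [LieGroup 𝓘(ℝ, ED) ∞ D]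
    [SimplyConnectedSpace D]
    (T : QuasiPoisson.ManinQuasiTriple (GroupLieAlgebra 𝓘(ℝ, ED) D))
    (G : Subgroup D)
    {EG : Type*} [NormedAddCommGroup EG] [NormedSpace ℝ EG] [FiniteDimensional ℝ EG]
    [ChartedSpace EG G] [LieGroup 𝓘(ℝ, EG) ∞ G] [SimplyConnectedSpace G]
    {ES : Type*} [NormedAddCommGroup ES] [NormedSpace ℝ ES] [FiniteDimensional ℝ ES]
    [ChartedSpace ES (D ⧸ G)] [IsManifold 𝓘(ℝ, ES) ∞ (D ⧸ G)]
    (P : QuasiPoisson.IsGroupPair (EG := EG) (ES := ES) T G)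
    {EX : Type*} [NormedAddCommGroup EX] [NormedSpace ℝ EX] [FiniteDimensional ℝ EX]
    (X : Type*) [TopologicalSpace X] [ChartedSpace EX X] [IsManifold 𝓘(ℝ, EX) ∞ X]
    [T2Space X] [SecondCountableTopology X] :
    ∃ e : QuasiPoisson.HamiltonianSpace 𝓘(ℝ, EX) X P.groupoid P.bivector P.trivector ≃
        QuasiPoisson.QuasiPoissonSpace P EX X,
      ∀ S : QuasiPoisson.HamiltonianSpace 𝓘(ℝ, EX) X P.groupoid P.bivector P.trivector,
        (e S).J = S.J ∧ (e S).bivector = S.bivector ∧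
        ∀ (g : G) (x : X), (e S).act g x = S.act (g, S.J x) x rfl :=
  ⟨QuasiPoisson.hamiltonianEquivQuasiPoisson, fun _ => ⟨rfl, rfl, fun _ _ => rfl⟩⟩
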